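/- **EBR is strongly applicable.** Consider $N$ threads in the asynchronous shared-memory model, and an implementation of an object whose operations are executed by these threads on a shared data structure. The data structure consists of nodes, which are reached from global entry points by following pointer fields, and memory is accessed by atomic primitives (reads, writes, and read-modify-write operations that return the previous value). Local variables are local to an operation, and pointers are used only for dereferencing, copying, marking and equality tests (no address arithmetic). The implementation contains calls of *alloc* and *retire*. It is a *plain implementation* if the following holds in all its executions without memory reclamation: (i) a node is retired only while it is active, i.e. allocated and not yet retired (so at most once); (ii) a node is not reachable from the entry points when it is retired, nor at any later time; (iii) every pointer held in a local variable of a thread during an operation refers to a node that has been reachable, or local to that thread (allocated by it, not retired, and never reachable so far), at some point during that operation. *Epoch-based reclamation (EBR)* has a global epoch counter, an array of announcements, one for each thread, and three retire lists per thread, indexed by the epoch modulo 3. After the invocation of each operation, *begin\_op* reads the global epoch $e$, announces it, may reclaim nodes in the thread's retire list of epoch $e-2$, then reads the announcements one by one, and, if each of them is $e$ or quiescent, increments the counter from $e$ to $e+1$ by a compare-and-swap. Before each operation returns, *end\_op* announces the quiescent state. *retire* reads the global epoch and inserts the retired node into the thread's retire list of that epoch. The address of a reclaimed node may be allocated again,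 as a different node. A pointer is *valid* if the node for which it was created (by an allocation, and then by copying) has not been reclaimed. Then EBR is applicable to every plain implementation, i.e. the implementation integrated with EBR has the following properties. 1. *Memory safety:* in each of its executions, every memory access that dereferences a pointer dereferences a valid pointer. 2. *Correctness:* it is linearizable with respect to every sequential specification with respect to which the plain implementation is linearizable. 3. *Progress:* it provides every progress guarantee that the plain implementation provides, among wait-freedom, lock-freedom, obstruction-freedom, starvation-freedom and deadlock-freedom. Here a pending invocation is *effective* if it is answered later or its thread performs infinitely many steps. An execution provides *maximal progress* if every effective pending invocation is answered, and *minimal progress* if, from each time at which an effective invocation is pending, some operation responds later. An implementation is wait-free if all executions provide maximal progress; lock-free if all executions provide minimal progress and some execution provides maximal progress; obstruction-free if every execution in which eventually at most one thread performs steps provides maximal progress; starvation-free if every fair execution (one in which no thread stops forever with a pending operation) provides maximal progress; and deadlock-free if every fair execution provides minimal progress and some fair execution provides maximal progress. -/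

import Mathlib

namespace SMR

/-! ## Words, programs, implementations -/

/-- Content of a shared memory cell or of a local variable: an integer (`val 0` doubles as the null
pointer), or a pointer carrying an integer mark.

Nodes are logical entities: `node` is the identity of the node that was allocated when the pointer
was created, and it travels with the pointer when the pointer is assigned. What is physically stored
is only the address of that node together with the mark; two nodes may occupy the same address one
after the other. Programs access memory by address and compare pointers by address (`Config.same`),
so they never see the identity. -/
inductive Word where
  | val (z : ℤ)
  | ptr (node : ℕ) (mark : ℤ)

/-- The integer part of a word (the mark, for a pointer). -/
def Word.data : Word → ℤ
  | .val z => z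
  | .ptr _ m => m

/-- Replace the integer part of a word; the referenced node does not change. -/
def Word.withData : Word → ℤ → Word
  | .val _, z => .val z
  | .ptr n _, z => .ptr n z

/-- Content of the local variables of a running operation. -/
abbrev Regs := ℕ → Word

/-- What integer computations see of the local variables: addresses are invisible to them
(there is no address arithmetic). -/
def Regs.data (ρ : Regs) : ℕ → ℤ := fun r => (ρ r).data

/-- A shared memory location: a global variable (entry point), or a field of the node whose address
is in the local variable `p`. The index may be computed. -/
inductive LocRef where
  | root (ix : (ℕ → ℤ) → ℕ)
  | field (p : ℕ) (ix : (ℕ → ℤ) → ℕ)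

/-- Atomic primitives on one shared location. All except `store` deliver the previous content of the
location into the local variable `dst` (so that a program learns the outcome of `cas` by comparing
`dst` with `expected`). -/
inductive Access where
  | load (dst : ℕ)
  | store (src : ℕ)
  | cas (dst expected new : ℕ)
  | swap (dst src : ℕ)
  | modify (dst : ℕ) (f : ℤ → (ℕ → ℤ) → ℤ)

inductive Instr where
  /-- `dst := f(integers)` -/
  | compute (dst : ℕ) (f : (ℕ → ℤ) → ℤ)
  /-- copy `src` to `dst`, setting the integer part (mark) to `mark(integers)` -/
  | move (dst src : ℕ) (mark : (ℕ → ℤ) → ℤ)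
  /-- `dst :=` an arbitrary integer (for example a random one) -/
  | choose (dst : ℕ)
  | jump (target : (ℕ → ℤ) → ℕ)
  /-- jump if the local variables `r` and `s` have the same physical content -/
  | jumpEq (r s target : ℕ)
  | access (l : LocRef) (a : Access)
  | alloc (dst : ℕ)
  | retire (p : ℕ)
  /-- return the integer part of the local variable `r` as the response of the operation -/
  | ret (r : ℕ)

/-- An implementation, by `N` threads, of an object with operations `Op` (an element of `Op` is an
operation together with its arguments): the code of every operation, and the initial
data structure, made of the nodes `0, …, initCount - 1` and the entry points. -/
structure Impl (N : ℕ) (Op : Type) where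
  code : Fin N → Op → ℕ → Instr
  initCount : ℕ
  initRoot : ℕ → Word
  initMem : ℕ → ℕ → Word
  initRoot_lt : ∀ i n m, initRoot i = .ptr n m → n < initCount
  initMem_lt : ∀ k i n m, initMem k i = .ptr n m → n < initCount

/-! ## Configurations -/

/-- Life-cycle of a node. Active nodes are local or shared, see `Exec.LocalTo`. -/
inductive Life where
  | unallocated
  | active
  | retired

/-- State of a thread: between operations, or executing an operation, with a program counter and the
local variables of that operation. -/
inductive Thread (Op : Type) where
  | idle
  | run (o : Op) (pc : ℕ) (ρ : Regs)

/-- Memory and threads. `mem a i` is field number `i` of the object at address `a`; `addr n` is the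
address that was given to node `n` at its allocation; nodes are numbered in the order of their
allocation and `fresh` is the number of the next one. -/
structure Config (N : ℕ) (Op : Type) where
  root : ℕ → Word
  mem : ℕ → ℕ → Word
  fresh : ℕ
  addr : ℕ → ℕ
  life : ℕ → Life
  allocator : ℕ → Option (Fin N)
  thr : Fin N → Thread Op

variable {N : ℕ} {Op : Type}

/-- A resolved location. -/
inductive Cell where
  | root (i : ℕ)
  | field (node i : ℕ)

/-- The location meant by a reference; dereferencing something that is not a pointer is a fault. -/
def LocRef.resolve (ρ : Regs) : LocRef → Option Cell
  | .root ix => some (.root (ix ρ.data))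
  | .field p ix =>
    match ρ p with
    | .val _ => none
    | .ptr n _ => some (.field n (ix ρ.data))

/-- The pointer that an access to this location dereferences. -/
def LocRef.deref (ρ : Regs) : LocRef → Option Word
  | .root _ => none
  | .field p _ => some (ρ p)

namespace Config

def setThr (c : Config N Op) (t : Fin N) (s : Thread Op) : Config N Op :=
  { c with thr := Function.update c.thr t s }

/-- Physical equality of words: same integer, or same address and same mark. -/
def same (c : Config N Op) : Word → Word → Bool
  | .val z, .val z' => decide (z = z')
  | .ptr n m, .ptr n' m' => decide (c.addr n = c.addr n' ∧ m = m')
  | _, _ => false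

def get (c : Config N Op) : Cell → Word
  | .root i => c.root i
  | .field n i => c.mem (c.addr n) i

def set (c : Config N Op) : Cell → Word → Config N Op
  | .root i, w => { c with root := Function.update c.root i w }
  | .field n i, w =>
    { c with mem := Function.update c.mem (c.addr n) (Function.update (c.mem (c.addr n)) i w) }

/-- Node `n` is reachable: it can be reached from an entry point by following pointer fields. -/
inductive Reachable (c : Config N Op) : ℕ → Prop
  | root (i n : ℕ) (m : ℤ) : c.root i = .ptr n m → Reachable c n
  | field (k i n : ℕ) (m : ℤ) : Reachable c k → c.mem (c.addr k) i = .ptr n m → Reachable c n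

/-- A word is a valid pointer if the node for which the pointer was created has not become
unallocated since its allocation (a node identity is never allocated twice). -/
def Valid (c : Config N Op) : Word → Prop
  | .val _ => False
  | .ptr n _ => c.life n ≠ .unallocated

end Config

/-- Content of the accessed cell after the access, `old` being its content before. -/
def Access.result (a : Access) (same : Word → Word → Bool) (ρ : Regs) (old : Word) : Word :=
  match a with
  | .load _ => old
  | .store s => ρ s
  | .cas _ e n => if same old (ρ e) then ρ n else old
  | .swap _ s => ρ s
  | .modify _ f => old.withData (f old.data ρ.data)

/-- Local variables after the access. -/
def Access.regs (a : Access) (ρ : Regs) (old : Word) : Regs :=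
  match a with
  | .load d => Function.update ρ d old
  | .store _ => ρ
  | .cas d _ _ => Function.update ρ d old
  | .swap d _ => Function.update ρ d old
  | .modify d _ => Function.update ρ d old

/-- Initially all threads are idle and exactly the nodes of the initial data structure exist. -/
def Impl.initial (I : Impl N Op) : Config N Op where
  root := I.initRoot
  mem := I.initMem
  fresh := I.initCount
  addr := id
  life := fun n => if n < I.initCount then .active else .unallocated
  allocator := fun _ => none
  thr := fun _ => .idle

/-! ## Steps, systems and executions -/

/-- Events recorded in a history: invocations and responses of operations. -/
inductive Event (Op : Type) where
  | inv (o : Op)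
  | res (v : ℤ)

/-- A step: the executing thread, the event if the step is an invocation or a response, and the
pointer that is dereferenced, if any. -/
structure Label (N : ℕ) (Op : Type) where
  tid : Fin N
  ev : Option (Event Op)
  deref : Option Word

/-- An idle thread invokes an operation; its local variables start out empty. -/
def InvokeStep (c : Config N Op) (t : Fin N) (o : Op) (c' : Config N Op) : Prop :=
  c.thr t = .idle ∧ c' = c.setThr t (.run o 0 (fun _ => .val 0))

/-- A thread returns the response `v` from its operation. -/
def RetStep (I : Impl N Op) (c : Config N Op) (t : Fin N) (v : ℤ) (c' : Config N Op) : Prop :=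
  ∃ o pc ρ r, c.thr t = .run o pc ρ ∧ I.code t o pc = .ret r ∧ v = (ρ r).data ∧
    c' = c.setThr t .idle

/-- A thread announces that node `n` is retired. -/
def RetireStep (I : Impl N Op) (c : Config N Op) (t : Fin N) (n : ℕ) (c' : Config N Op) : Prop :=
  ∃ o pc ρ r m, c.thr t = .run o pc ρ ∧ I.code t o pc = .retire r ∧ ρ r = .ptr n m ∧
    c' = { c with
      life := Function.update c.life n
        (match c.life n with
          | .unallocated => .unallocated
          | _ => .retired)
      thr := Function.update c.thr t (.run o (pc + 1) ρ) }

/-- The remaining instructions; the `Option Word` is the dereferenced pointer. `alloc` may return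
every address that is not occupied by a node, and initializes the new node. -/
inductive BodyStep (I : Impl N Op) (c : Config N Op) (t : Fin N) :
    Option Word → Config N Op → Prop
  | compute (o pc ρ d f) : c.thr t = .run o pc ρ → I.code t o pc = .compute d f →
      BodyStep I c t none (c.setThr t (.run o (pc + 1) (Function.update ρ d (.val (f ρ.data)))))
  | move (o pc ρ d s f) : c.thr t = .run o pc ρ → I.code t o pc = .move d s f →
      BodyStep I c t none
        (c.setThr t (.run o (pc + 1) (Function.update ρ d ((ρ s).withData (f ρ.data)))))
  | choose (o pc ρ d z) : c.thr t = .run o pc ρ → I.code t o pc = .choose d →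
      BodyStep I c t none (c.setThr t (.run o (pc + 1) (Function.update ρ d (.val z))))
  | jump (o pc ρ f) : c.thr t = .run o pc ρ → I.code t o pc = .jump f →
      BodyStep I c t none (c.setThr t (.run o (f ρ.data) ρ))
  | jumpEq (o pc ρ r s q) : c.thr t = .run o pc ρ → I.code t o pc = .jumpEq r s q →
      BodyStep I c t none
        (c.setThr t (.run o (if c.same (ρ r) (ρ s) then q else pc + 1) ρ))
  | access (o pc ρ l a cell) : c.thr t = .run o pc ρ → I.code t o pc = .access l a →
      l.resolve ρ = some cell →
      BodyStep I c t (l.deref ρ)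
        ((c.set cell (a.result c.same ρ (c.get cell))).setThr t
          (.run o (pc + 1) (a.regs ρ (c.get cell))))
  | alloc (o pc ρ d x) : c.thr t = .run o pc ρ → I.code t o pc = .alloc d →
      (∀ n, c.life n ≠ .unallocated → c.addr n ≠ x) →
      BodyStep I c t none
        { c with
          mem := Function.update c.mem x (fun _ => .val 0)
          fresh := c.fresh + 1
          addr := Function.update c.addr c.fresh x
          life := Function.update c.life c.fresh .active
          allocator := Function.update c.allocator c.fresh (some t)
          thr := Function.update c.thr t
            (.run o (pc + 1) (Function.update ρ d (.ptr c.fresh 0))) }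

/-- A transition system executed by `N` threads; `core` is the part of a configuration that holds
the memory, the nodes and the state of the program. -/
structure System (N : ℕ) (Op : Type) where
  Conf : Type
  start : Conf
  step : Conf → Label N Op → Conf → Prop
  core : Conf → Config N Op

/-- An execution. `lab i = none` means that nothing happens at time `i`; a finite execution is one
in which nothing happens from some time on. -/
structure Exec (M : System N Op) where
  conf : ℕ → M.Conf
  lab : ℕ → Option (Label N Op)
  start : conf 0 = M.start
  step : ∀ i, match lab i with
    | none => conf (i + 1) = conf i
    | some l => M.step (conf i) l (conf (i + 1))

/-! ## Plain implementations -/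

/-- Steps without memory reclamation: `retire` only changes the life-cycle state. -/
inductive PlainStep (I : Impl N Op) : Config N Op → Label N Op → Config N Op → Prop
  | invoke (c t o c') : InvokeStep c t o c' → PlainStep I c ⟨t, some (.inv o), none⟩ c'
  | body (c t d c') : BodyStep I c t d c' → PlainStep I c ⟨t, none, d⟩ c'
  | retire (c t n c') : RetireStep I c t n c' → PlainStep I c ⟨t, none, none⟩ c'
  | ret (c t v c') : RetStep I c t v c' → PlainStep I c ⟨t, some (.res v), none⟩ c'

/-- The implementation run without memory reclamation. -/
abbrev plain (I : Impl N Op) : System N Op where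
  Conf := Config N Op
  start := I.initial
  step := PlainStep I
  core := id

/-- At time `j`, node `n` is local to thread `t`: allocated by `t`, not retired, and not made
reachable so far. -/
def Exec.LocalTo {M : System N Op} (E : Exec M) (j n : ℕ) (t : Fin N) : Prop :=
  (M.core (E.conf j)).life n = .active ∧ (M.core (E.conf j)).allocator n = some t ∧
    ∀ k ≤ j, ¬ (M.core (E.conf k)).Reachable n

/-- The standing assumptions on a plain implementation, about its executions without reclamation:
* a node is retired only while it is active (in particular at most once);
* a node is not reachable when it is retired, nor ever after;
* a thread in an operation has access (through its local variables) only to nodes that have been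
  reachable, or local to that thread, at some point during that operation. -/
structure IsPlain (I : Impl N Op) : Prop where
  retire_active : ∀ (E : Exec (plain I)) (i : ℕ) t o pc ρ r n m,
    (E.conf i).thr t = .run o pc ρ → I.code t o pc = .retire r → ρ r = .ptr n m →
      (E.conf i).life n = .active
  retired_unreachable : ∀ (E : Exec (plain I)) (i n : ℕ),
    (E.conf i).life n = .retired → ¬ (E.conf i).Reachable n
  access_scope : ∀ (E : Exec (plain I)) (i : ℕ) t o pc ρ r n m,
    (E.conf i).thr t = .run o pc ρ → ρ r = .ptr n m →
      ∃ j ≤ i, (∀ k, j ≤ k → k ≤ i → (E.conf k).thr t ≠ .idle) ∧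
        ((E.conf j).Reachable n ∨ E.LocalTo j n t)

/-! ## Epoch-based reclamation -/

/-- Where a thread is with respect to the code inserted by EBR. -/
inductive Phase where
  /-- not in an operation -/
  | out
  /-- `begin_op`: about to read the global epoch -/
  | beginRead
  /-- `begin_op`: has read epoch `e`, about to announce it -/
  | announce (e : ℕ)
  /-- `begin_op`: may reclaim nodes of the retire list of epoch `e - 2` -/
  | reclaim (e : ℕ)
  /-- `begin_op`: threads `0, …, k - 1` were seen to have announced `e` or to be quiescent -/
  | scan (e k : ℕ)
  /-- in the code of the plain implementation -/
  | body
  /-- `retire`: has read epoch `e`, about to insert node `n` into its retire list -/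
  | insert (n e : ℕ)
  /-- `end_op` is done, about to return -/
  | ended

/-- Configurations of the integrated implementation: the global epoch counter, the announcements
(`none` is the quiescent state), and three retire lists per thread, the list of epoch `e` being
the one with index `e` modulo 3. -/
structure EBRConf (N : ℕ) (Op : Type) where
  core : Config N Op
  epoch : ℕ
  ann : Fin N → Option ℕ
  lists : Fin N → Fin 3 → List ℕ
  phase : Fin N → Phase

def EBRConf.setPhase (s : EBRConf N Op) (t : Fin N) (p : Phase) : EBRConf N Op :=
  { s with phase := Function.update s.phase t p }

def EBRConf.setList (s : EBRConf N Op) (t : Fin N) (k : Fin 3) (l : List ℕ) : EBRConf N Op :=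
  { s with lists := Function.update s.lists t (Function.update (s.lists t) k l) }

/-- The steps of the implementation integrated with EBR: `begin_op` is inserted after each
invocation, `end_op` before each return, and `retire` is replaced by that of EBR. Every access to
the epoch counter or to an entry of the announcements is a separate atomic step. Modulo 3, the
epoch `e - 2` is `e + 1`. -/
inductive EBRStep (I : Impl N Op) : EBRConf N Op → Label N Op → EBRConf N Op → Prop
  | invoke (s t o c') : s.phase t = .out → InvokeStep s.core t o c' →
      EBRStep I s ⟨t, some (.inv o), none⟩ ({ s with core := c' }.setPhase t .beginRead)
  | read (s t) : s.phase t = .beginRead →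
      EBRStep I s ⟨t, none, none⟩ (s.setPhase t (.announce s.epoch))
  | announce (s t e) : s.phase t = .announce e →
      EBRStep I s ⟨t, none, none⟩
        ({ s with ann := Function.update s.ann t (some e) }.setPhase t (.reclaim e))
  | reclaim (s t e n l) : s.phase t = .reclaim e → s.lists t (Fin.ofNat 3 (e + 1)) = n :: l →
      EBRStep I s ⟨t, none, none⟩
        ({ s with
            core := { s.core with life := Function.update s.core.life n .unallocated }
          }.setList t (Fin.ofNat 3 (e + 1)) l)
  | reclaimDone (s t e) : s.phase t = .reclaim e →
      EBRStep I s ⟨t, none, none⟩ (s.setPhase t (.scan e 0))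
  | scanNext (s t e) (u : Fin N) : s.phase t = .scan e u → (s.ann u = none ∨ s.ann u = some e) →
      EBRStep I s ⟨t, none, none⟩ (s.setPhase t (.scan e (u + 1)))
  | scanFail (s t e) (u : Fin N) : s.phase t = .scan e u → ¬ (s.ann u = none ∨ s.ann u = some e) →
      EBRStep I s ⟨t, none, none⟩ (s.setPhase t .body)
  /-- all threads passed the check: increment the counter by a compare-and-swap from `e` -/
  | advance (s t e) : s.phase t = .scan e N →
      EBRStep I s ⟨t, none, none⟩
        ({ s with epoch := if s.epoch = e then e + 1 else s.epoch }.setPhase t .body)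
  | body (s t d c') : s.phase t = .body → BodyStep I s.core t d c' →
      EBRStep I s ⟨t, none, d⟩ { s with core := c' }
  | retire (s t n c') : s.phase t = .body → RetireStep I s.core t n c' →
      EBRStep I s ⟨t, none, none⟩ ({ s with core := c' }.setPhase t (.insert n s.epoch))
  | insert (s t n e) : s.phase t = .insert n e →
      EBRStep I s ⟨t, none, none⟩
        ((s.setList t (Fin.ofNat 3 e) (n :: s.lists t (Fin.ofNat 3 e))).setPhase t .body)
  | endOp (s t v c') : s.phase t = .body → RetStep I s.core t v c' →
      EBRStep I s ⟨t, none, none⟩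
        ({ s with ann := Function.update s.ann t none }.setPhase t .ended)
  | ret (s t v c') : s.phase t = .ended → RetStep I s.core t v c' →
      EBRStep I s ⟨t, some (.res v), none⟩ ({ s with core := c' }.setPhase t .out)

/-- A reclamation scheme turns an implementation into an integrated one. -/
abbrev Scheme (N : ℕ) (Op : Type) := Impl N Op → System N Op

/-- Epoch-based reclamation. -/
abbrev ebr (N : ℕ) (Op : Type) : Scheme N Op := fun I =>
  { Conf := EBRConf N Op
    start :=
      { core := I.initial
        epoch := 0
        ann := fun _ => none
        lists := fun _ _ => []
        phase := fun _ => .out }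
    step := EBRStep I
    core := EBRConf.core }

/-! ## Memory safety -/

/-- In every execution, every dereferenced pointer is valid. -/
def MemorySafe (M : System N Op) : Prop :=
  ∀ (E : Exec M) (i : ℕ) (l : Label N Op) (w : Word), E.lab i = some l → l.deref = some w →
    (M.core (E.conf i)).Valid w

/-! ## Histories and linearizability -/

/-- A finite history. -/
abbrev History (N : ℕ) (Op : Type) := List (Fin N × Event Op)

/-- The history of the first `m` time units of an execution. -/
def Exec.history {M : System N Op} (E : Exec M) (m : ℕ) : History N Op :=
  (List.range m).filterMap fun i => (E.lab i).bind fun l => l.ev.map fun e => (l.tid, e)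

def Event.isInv : Event Op → Bool
  | .inv _ => true
  | .res _ => false

/-- The sub-history of thread `t`. -/
def History.proj (H : History N Op) (t : Fin N) : History N Op := H.filter fun x => x.1 = t

/-- Number of invocations by thread `t`. -/
def History.invs (H : History N Op) (t : Fin N) : ℕ :=
  H.countP fun x => decide (x.1 = t) && x.2.isInv

/-- Number of responses to thread `t`. -/
def History.ress (H : History N Op) (t : Fin N) : ℕ :=
  H.countP fun x => decide (x.1 = t) && !x.2.isInv

/-- Remove the pending invocations (those that are not followed by an event of their thread). -/
def History.dropPending : History N Op → History N Op
  | [] => []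
  | x :: l =>
    if x.2.isInv = true ∧ ∀ y ∈ l, y.1 ≠ x.1 then History.dropPending l
    else x :: History.dropPending l

/-- The response of operation number `i` of thread `t` precedes the invocation of operation
number `j` of thread `u` (numbers start at 0). -/
def History.Precedes (H : History N Op) (t : Fin N) (i : ℕ) (u : Fin N) (j : ℕ) : Prop :=
  ∃ A B v, H = A ++ (t, .res v) :: B ∧ History.ress A t = i ∧ History.invs A u ≤ j ∧ j < H.invs u

/-- The complete sequential history in which the listed operations are executed in this order. -/
def seqHistory (S : List (Fin N × Op × ℤ)) : History N Op :=
  S.flatMap fun x => [(x.1, .inv x.2.1), (x.1, .res x.2.2)]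

/-- `H` is linearizable with respect to a sequential specification (a set of sequential histories,
given as sequences of operations with their responses): responses can be appended to some pending
invocations, and the other pending invocations removed, in such a way that the outcome is equivalent
to some sequential history `S` of the specification, which respects the order between responses and
invocations. Equivalence to `S` forces the outcome to be complete and well-formed. -/
def LinearizableHistory (spec : Set (List (Fin N × Op × ℤ))) (H : History N Op) : Prop :=
  ∃ R : History N Op, (∀ x ∈ R, x.2.isInv = false) ∧
    ∃ S ∈ spec,
      (∀ t, (History.dropPending (H ++ R)).proj t = (seqHistory S).proj t) ∧
      ∀ t i u j, (History.dropPending (H ++ R)).Precedes t i u j →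
        (seqHistory S).Precedes t i u j

/-- All histories are linearizable. -/
def Linearizable (M : System N Op) (spec : Set (List (Fin N × Op × ℤ))) : Prop :=
  ∀ (E : Exec M) (m : ℕ), LinearizableHistory spec (E.history m)

/-! ## Progress -/

namespace Exec

variable {M : System N Op} (E : Exec M)

/-- Thread `t` performs the step at time `i`. -/
def Moves (t : Fin N) (i : ℕ) : Prop := ∃ l, E.lab i = some l ∧ l.tid = t

def InvokesAt (t : Fin N) (i : ℕ) : Prop := ∃ l o, E.lab i = some l ∧ l.tid = t ∧ l.ev = some (.inv o)

def RespondsAt (t : Fin N) (i : ℕ) : Prop := ∃ l v, E.lab i = some l ∧ l.tid = t ∧ l.ev = some (.res v)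

/-- Thread `t` has a pending invocation at time `k`. -/
def Pending (t : Fin N) (k : ℕ) : Prop :=
  ∃ i < k, E.InvokesAt t i ∧ ∀ j, i < j → j < k → ¬ E.RespondsAt t j

/-- Thread `t` has a pending invocation at time `k`, and that invocation is effective: it is answered
later, or `t` never stops performing steps. -/
def PendingEffective (t : Fin N) (k : ℕ) : Prop :=
  E.Pending t k ∧ ((∃ i ≥ k, E.RespondsAt t i) ∨ ∀ m, ∃ i ≥ m, E.Moves t i)

/-- From every time at which an effective invocation is pending, some operation responds later. -/
def MinimalProgress : Prop :=
  ∀ k, (∃ t, E.PendingEffective t k) → ∃ i ≥ k, ∃ t, E.RespondsAt t i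

/-- Every effective pending invocation is answered. -/
def MaximalProgress : Prop :=
  ∀ k t, E.PendingEffective t k → ∃ i ≥ k, E.RespondsAt t i

/-- No thread stops in the middle of an operation. -/
def Fair : Prop := ∀ t k, E.Pending t k → ∃ i ≥ k, E.Moves t i

/-- From some time on, the execution is a solo-run. -/
def EventuallySolo : Prop := ∃ t m, ∀ i ≥ m, ∀ u, E.Moves u i → u = t

end Exec

inductive ProgressGuarantee where
  | waitFree
  | lockFree
  | obstructionFree
  | starvationFree
  | deadlockFree

def Provides (M : System N Op) : ProgressGuarantee → Prop
  | .waitFree => ∀ E : Exec M, E.MaximalProgress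
  | .lockFree => (∀ E : Exec M, E.MinimalProgress) ∧ ∃ E : Exec M, E.MaximalProgress
  | .obstructionFree => ∀ E : Exec M, E.EventuallySolo → E.MaximalProgress
  | .starvationFree => ∀ E : Exec M, E.Fair → E.MaximalProgress
  | .deadlockFree => (∀ E : Exec M, E.Fair → E.MinimalProgress) ∧
      ∃ E : Exec M, E.Fair ∧ E.MaximalProgress

/-! ## Applicability -/

/-- The scheme is applicable to the implementation: the integrated implementation is memory-safe, is
linearizable with respect to every specification with respect to which the plain one is, and
provides every progress guarantee that the plain one provides. -/
structure Applicable (S : Scheme N Op) (I : Impl N Op) : Prop where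
  safe : MemorySafe (S I)
  correct : ∀ spec, Linearizable (plain I) spec → Linearizable (S I) spec
  progress : ∀ g, Provides (plain I) g → Provides (S I) g

/-- The scheme is applicable to every plain implementation. -/
def StronglyApplicable (S : Scheme N Op) : Prop :=
  ∀ I : Impl N Op, IsPlain I → Applicable S I

end SMR

/-!
Every execution of the implementation integrated with EBR is simulated by an execution of the plain
implementation in which nodes are never reclaimed and node `n` has address `n`. Both agree on the
entry points, the local variables and the content of all nodes that are not reclaimed
(`Config.Mirrors`). A step of the program can be repeated in the plain execution as long as it neither
dereferences nor compares pointers to reclaimed nodes (`Config.Mirrors.body`): addresses of other nodes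
are pairwise different, so comparing addresses amounts to comparing nodes.

That no such pointer occurs follows from two facts. While the announcement of a thread `t` is in
force, the epoch is at most `base t + 1`, where `base t` is the epoch at the time of the announcement
(`EBRConf.EpochInv.step`); and a node is reclaimed only when the epoch is at least two larger than the
one in which it was retired (`EBRConf.ListInv`). So a node retired after the announcement of `t` is not
reclaimed during the operation of `t`. On the other hand, a node referenced by a local variable of `t`
was not yet retired at some time during the operation, by the access rule for plain implementations
(`PlainReach.seen_of_reg`). This time could precede the announcement. Therefore the access rule
is applied to a second plain execution, in which an operation is invoked only at the end of `begin_op`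
(`EBRConf.delayed`); both plain executions have the same memory.

The plain execution in which operations start when they are invoked has the same history, which gives
linearizability. Its steps are the steps of the integrated implementation outside the code of EBR, and
that code is wait-free: a thread performs boundedly many steps in it before it performs a step of
the program (`EBRConf.overhead`). So a thread performs infinitely many steps in one execution if and
only if it does in the other, and the progress guarantees carry over.
-/

namespace SMR

variable {N : ℕ} {Op : Type}

/-! ### Reachable configurations of a plain implementation -/

/-- Configurations reached by finite plain executions, together with the relation `A t n`: node `n`
was not yet retired at some time during the current operation of thread `t`. -/
inductive PlainReach (I : Impl N Op) : Config N Op → (Fin N → ℕ → Prop) → Prop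
  | start : PlainReach I I.initial (fun _ _ => False)
  | step (c A l c') : PlainReach I c A → PlainStep I c l c' →
      PlainReach I c' (fun t n => c'.thr t ≠ .idle ∧ (A t n ∨ c'.life n ≠ .retired))

/-- The execution in which nothing happens. -/
def Exec.stutter (M : System N Op) : Exec M where
  conf := fun _ => M.start
  lab := fun _ => none
  start := rfl
  step := fun _ => rfl

/-- A reached configuration occurs in an infinite execution that stops there, so that the assumptions
of `IsPlain` apply to it. -/
theorem PlainReach.exists_exec {I : Impl N Op} {c : Config N Op} {A : Fin N → ℕ → Prop}
    (h : PlainReach I c A) : ∃ (E : Exec (plain I)) (i : ℕ), E.conf i = c ∧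
      (∀ k, i ≤ k → E.lab k = none) ∧
      ∀ t n j, j ≤ i → (∀ k, j ≤ k → k ≤ i → (E.conf k).thr t ≠ .idle) →
        (E.conf j).life n ≠ .retired → A t n := by
  induction h with
  | start =>
    refine ⟨Exec.stutter _, 0, rfl, fun _ _ => rfl, fun t n j hj hk _ => ?_⟩
    exact hk 0 (by omega) le_rfl rfl
  | step c A l c' _ hs ih =>
    obtain ⟨E, i, hc, hlab, hA⟩ := ih
    refine ⟨⟨fun k => if k ≤ i then E.conf k else c', fun k => if k = i then some l else E.lab k,
      by simpa using E.start, fun k => ?_⟩, i + 1, by simp, fun k hk => ?_, fun t n j hj hk hn => ?_⟩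
    · rcases lt_trichotomy k i with hk | rfl | hk
      · have := E.step k
        simpa [hk.ne, hk.le, Nat.succ_le_of_lt hk] using this
      · simpa [hc] using hs
      · have h1 : ¬ k ≤ i := by omega
        have h2 : ¬ k + 1 ≤ i := by omega
        simp [hk.ne', hlab k hk.le, h1, h2]
    · have h1 : k ≠ i := by omega
      simp [h1, hlab k (by omega)]
    · refine ⟨by simpa using hk (i + 1) hj le_rfl, ?_⟩
      rcases Nat.lt_or_ge i j with h | h
      · right
        have : ¬ j ≤ i := by omega
        simpa [this] using hn
      · left
        refine hA t n j h (fun k h1 h2 => ?_) (by simpa [h] using hn)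
        simpa [h2] using hk k h1 (by omega)

theorem PlainReach.thr_ne_idle {I : Impl N Op} {c : Config N Op} {A : Fin N → ℕ → Prop}
    (h : PlainReach I c A) {t : Fin N} {n : ℕ} (hn : A t n) : c.thr t ≠ .idle := by
  cases h with
  | start => exact hn.elim
  | step c A l c' _ hs => exact hn.1

/-- The only consequence of `IsPlain.access_scope` that is needed: a reachable or local node is not
retired, so a node referenced by a local variable was not yet retired at some time during the current
operation. -/
theorem PlainReach.seen_of_reg {I : Impl N Op} (hI : IsPlain I) {c : Config N Op}
    {A : Fin N → ℕ → Prop} (h : PlainReach I c A) {t : Fin N} {o pc ρ r n m}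
    (ht : c.thr t = .run o pc ρ) (hr : ρ r = .ptr n m) : A t n := by
  obtain ⟨E, i, rfl, -, hA⟩ := h.exists_exec
  obtain ⟨j, hj, hk, hn⟩ := hI.access_scope E i t o pc ρ r n m ht hr
  refine hA t n j hj hk fun hret => ?_
  rcases hn with hn | hn
  · exact hI.retired_unreachable E j n hret hn
  · have : (E.conf j).life n = .active := hn.1
    simp [this] at hret

theorem PlainReach.active_of_retire {I : Impl N Op} (hI : IsPlain I) {c : Config N Op}
    {A : Fin N → ℕ → Prop} (h : PlainReach I c A) {t : Fin N} {o pc ρ r n m}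
    (ht : c.thr t = .run o pc ρ) (hc : I.code t o pc = .retire r) (hr : ρ r = .ptr n m) :
    c.life n = .active := by
  obtain ⟨E, i, rfl, -, -⟩ := h.exists_exec
  exact hI.retire_active E i t o pc ρ r n m ht hc hr

/-- Pointers refer to nodes that have been allocated, and these are the nodes below `fresh`. -/
structure Config.WellFormed (c : Config N Op) : Prop where
  root : ∀ i n m, c.root i = .ptr n m → n < c.fresh
  mem : ∀ k i n m, c.mem k i = .ptr n m → n < c.fresh
  regs : ∀ t o pc ρ r n m, c.thr t = .run o pc ρ → ρ r = .ptr n m → n < c.fresh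
  life : ∀ n, c.life n = .unallocated ↔ c.fresh ≤ n

theorem Word.withData_eq_ptr {w : Word} {z n m} (h : w.withData z = .ptr n m) :
    ∃ m', w = .ptr n m' := by
  cases w <;> simp_all [Word.withData]

theorem Access.result_eq_ptr {a : Access} {same ρ old n m} (h : a.result same ρ old = .ptr n m) :
    (∃ m', old = .ptr n m') ∨ ∃ r m', ρ r = .ptr n m' := by
  cases a with
  | modify d f => exact .inl (Word.withData_eq_ptr h)
  | cas d e w =>
    simp only [Access.result] at h
    split_ifs at h
    exacts [.inr ⟨_, _, h⟩, .inl ⟨_, h⟩]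
  | load d => exact .inl ⟨_, h⟩
  | _ => exact .inr ⟨_, _, h⟩

theorem Access.regs_eq_ptr {a : Access} {ρ old r n m} (h : a.regs ρ old r = .ptr n m) :
    (∃ m', old = .ptr n m') ∨ ∃ r m', ρ r = .ptr n m' := by
  cases a <;> simp only [Access.regs, Function.update_apply] at h <;> try split_ifs at h
  all_goals first | exact .inl ⟨_, h⟩ | exact .inr ⟨_, _, h⟩

theorem Config.WellFormed.setThr {c : Config N Op} (h : c.WellFormed) {t : Fin N} {s : Thread Op}
    (hs : ∀ o pc ρ r n m, s = .run o pc ρ → ρ r = .ptr n m → n < c.fresh) :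
    (c.setThr t s).WellFormed where
  root := h.root
  mem := h.mem
  regs := fun u o pc ρ r n m hu hr => by
    by_cases hut : u = t
    · subst hut
      exact hs o pc ρ r n m (by simpa [Config.setThr] using hu) hr
    · exact h.regs u o pc ρ r n m (by simpa [Config.setThr, hut] using hu) hr
  life := h.life

theorem Config.WellFormed.get {c : Config N Op} (h : c.WellFormed) {cell n m}
    (hg : c.get cell = .ptr n m) : n < c.fresh := by
  cases cell
  exacts [h.root _ _ _ hg, h.mem _ _ _ _ hg]

theorem Config.WellFormed.set {c : Config N Op} (h : c.WellFormed) {cell w}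
    (hw : ∀ n m, w = .ptr n m → n < c.fresh) : (c.set cell w).WellFormed := by
  cases cell with
  | root i =>
    refine ⟨fun j n m hj => ?_, h.mem, h.regs, h.life⟩
    simp only [Config.set, Function.update_apply] at hj
    split_ifs at hj
    exacts [hw _ _ hj, h.root _ _ _ hj]
  | field k i =>
    refine ⟨h.root, fun a j n m hj => ?_, h.regs, h.life⟩
    simp only [Config.set, Function.update_apply] at hj
    split_ifs at hj with h1
    · simp only [Function.update_apply] at hj
      split_ifs at hj
      exacts [hw _ _ hj, h.mem _ _ _ _ hj]
    · exact h.mem _ _ _ _ hj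

theorem Config.WellFormed.step {I : Impl N Op} {c : Config N Op} {l : Label N Op}
    {c' : Config N Op} (h : c.WellFormed) (hs : PlainStep I c l c') : c'.WellFormed := by
  cases hs with
  | invoke t o _ hi =>
    obtain ⟨-, rfl⟩ := hi
    exact h.setThr (by rintro _ _ _ r n m ⟨⟩ hr; cases hr)
  | ret t v _ hi =>
    obtain ⟨_, _, _, _, -, -, -, rfl⟩ := hi
    exact h.setThr (by rintro _ _ _ r n m ⟨⟩)
  | retire t n _ hi =>
    obtain ⟨o, pc, ρ, r, m, ht, -, -, rfl⟩ := hi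
    have h' := h.setThr (t := t) (s := .run o (pc + 1) ρ)
      (by rintro _ _ _ r n m ⟨⟩ hr; exact h.regs _ _ _ _ _ _ _ ht hr)
    refine ⟨h'.root, h'.mem, h'.regs, fun k => ?_⟩
    rw [← h.life k]
    simp only [Function.update_apply]
    split_ifs with hk
    · subst hk
      cases c.life k <;> simp
    · rfl
  | body t d _ hi =>
    cases hi with
    | compute o pc ρ d f ht hc =>
      refine h.setThr ?_
      rintro _ _ _ r n m ⟨⟩ hr
      simp only [Function.update_apply] at hr
      split_ifs at hr
      exact h.regs _ _ _ _ _ _ _ ht hr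
    | move o pc ρ d s f ht hc =>
      refine h.setThr ?_
      rintro _ _ _ r n m ⟨⟩ hr
      simp only [Function.update_apply] at hr
      split_ifs at hr
      · obtain ⟨m', hm⟩ := Word.withData_eq_ptr hr
        exact h.regs _ _ _ _ _ _ _ ht hm
      · exact h.regs _ _ _ _ _ _ _ ht hr
    | choose o pc ρ d z ht hc =>
      refine h.setThr ?_
      rintro _ _ _ r n m ⟨⟩ hr
      simp only [Function.update_apply] at hr
      split_ifs at hr
      exact h.regs _ _ _ _ _ _ _ ht hr
    | jump o pc ρ f ht hc =>
      refine h.setThr ?_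
      rintro _ _ _ r n m ⟨⟩ hr
      exact h.regs _ _ _ _ _ _ _ ht hr
    | jumpEq o pc ρ r s q ht hc =>
      refine h.setThr ?_
      rintro _ _ _ r n m ⟨⟩ hr
      exact h.regs _ _ _ _ _ _ _ ht hr
    | access o pc ρ l a cell ht hc hl =>
      have hfresh : ∀ w, (c.set cell w).fresh = c.fresh := by
        intro w; cases cell <;> rfl
      refine (h.set fun n m hw => ?_).setThr ?_
      · rcases Access.result_eq_ptr hw with ⟨m', hm⟩ | ⟨r, m', hm⟩
        exacts [h.get hm, h.regs _ _ _ _ _ _ _ ht hm]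
      · rintro _ _ _ r n m ⟨⟩ hr
        rw [hfresh]
        rcases Access.regs_eq_ptr hr with ⟨m', hm⟩ | ⟨r, m', hm⟩
        exacts [h.get hm, h.regs _ _ _ _ _ _ _ ht hm]
    | alloc o pc ρ d x ht hc hx =>
      refine ⟨fun i n m hi => (h.root _ _ _ hi).trans (Nat.lt_succ_self _), fun k i n m hk => ?_,
        fun u o' pc' ρ' r n m hu hr => ?_, fun n => ?_⟩
      · simp only [Function.update_apply] at hk
        split_ifs at hk
        exact (h.mem _ _ _ _ hk).trans (Nat.lt_succ_self _)
      · simp only [Function.update_apply] at hu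
        split_ifs at hu with hut
        · cases hu
          simp only [Function.update_apply] at hr
          split_ifs at hr
          · cases hr
            exact Nat.lt_succ_self _
          · exact (h.regs _ _ _ _ _ _ _ ht hr).trans (Nat.lt_succ_self _)
        · exact (h.regs _ _ _ _ _ _ _ hu hr).trans (Nat.lt_succ_self _)
      · have := h.life n
        simp only [Function.update_apply]
        split_ifs with hn
        · simp [hn]
        · rw [this]
          omega

theorem PlainReach.wellFormed {I : Impl N Op} {c : Config N Op} {A : Fin N → ℕ → Prop}
    (h : PlainReach I c A) : c.WellFormed := by
  induction h with
  | start =>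
    refine ⟨I.initRoot_lt, I.initMem_lt, fun t o pc ρ r n m ht => (by cases ht), fun n => ?_⟩
    simp only [Impl.initial]
    split_ifs with hn <;> simp <;> omega
  | step c A l c' _ hs ih => exact ih.step hs

/-! ### The unreclaimed copy of a configuration -/

/-- The configuration of the program run without reclamation that corresponds to `c`. Every node
occupies the address equal to its number, so that addresses are never reused, and memory, life-cycle
states and threads are given separately. -/
def Config.copy (c : Config N Op) (m : ℕ → ℕ → Word) (l : ℕ → Life) (th : Fin N → Thread Op) :
    Config N Op where
  root := c.root
  mem := m
  fresh := c.fresh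
  addr := id
  life := l
  allocator := c.allocator
  thr := th

/-- The memory `m` and the life-cycle states `l` of a run without reclamation agree with `c` on the
nodes that are not reclaimed, and reclaimed nodes are retired in `l`. Nodes that are not reclaimed
have different addresses in `c`. -/
structure Config.Mirrors (c : Config N Op) (m : ℕ → ℕ → Word) (l : ℕ → Life) : Prop where
  life : ∀ n, c.life n = l n ∨ (c.life n = .unallocated ∧ l n = .retired)
  mem : ∀ n, c.life n ≠ .unallocated → c.mem (c.addr n) = m n
  inj : ∀ n k, c.life n ≠ .unallocated → c.life k ≠ .unallocated → c.addr n = c.addr k → n = k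

/-- On pointers to nodes that are not reclaimed, comparing addresses is comparing nodes. -/
theorem Config.Mirrors.same_eq {c : Config N Op} {m l} (h : c.Mirrors m l) (th) {v w : Word}
    (hv : ∀ n k, v = .ptr n k → c.life n ≠ .unallocated)
    (hw : ∀ n k, w = .ptr n k → c.life n ≠ .unallocated) :
    (c.copy m l th).same v w = c.same v w := by
  cases v with
  | val z => cases w <;> rfl
  | ptr n k =>
    cases w with
    | val z => rfl
    | ptr n' k' =>
      have hinj := h.inj n n' (hv _ _ rfl) (hw _ _ rfl)
      exact decide_eq_decide.2
        ⟨fun e => ⟨congrArg c.addr e.1, e.2⟩, fun e => ⟨hinj e.1, e.2⟩⟩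

theorem LocRef.resolve_eq_field {L : LocRef} {ρ : Regs} {n i : ℕ}
    (h : L.resolve ρ = some (.field n i)) : ∃ r k, ρ r = .ptr n k := by
  cases L with
  | root ix => cases h
  | field p ix =>
    simp only [LocRef.resolve] at h
    split at h
    · cases h
    · rename_i n' k hp
      cases h
      exact ⟨p, k, hp⟩

theorem Access.result_congr {a : Access} {s s' : Word → Word → Bool} {ρ : Regs} {old : Word}
    (h : ∀ d e w, a = .cas d e w → s old (ρ e) = s' old (ρ e)) :
    a.result s ρ old = a.result s' ρ old := by
  cases a with
  | cas d e w => simp [Access.result, h d e w rfl]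
  | _ => rfl

/-- A step of the program can be repeated without reclamation if the local variables of its thread,
and the old content delivered by a compare-and-swap, do not refer to reclaimed nodes. The threads `th`
other than `t` may be in an arbitrary state: the lemma serves both for a run in which operations
start when they are invoked and for one in which they start later. -/
theorem Config.Mirrors.body {I : Impl N Op} {c c' : Config N Op} {m l} (h : c.Mirrors m l)
    {t : Fin N} {d} (hfresh : ∀ n, l n = .unallocated ↔ c.fresh ≤ n)
    (hreg : ∀ o pc ρ r n k, c.thr t = .run o pc ρ → ρ r = .ptr n k → c.life n ≠ .unallocated)
    (hcas : ∀ o pc ρ L d e w cell n k, c.thr t = .run o pc ρ →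
      I.code t o pc = .access L (.cas d e w) → L.resolve ρ = some cell →
      (c.copy m l c.thr).get cell = .ptr n k → c.life n ≠ .unallocated)
    (hb : BodyStep I c t d c') :
    ∃ m' l', c'.Mirrors m' l' ∧
      (∀ th, th t = c.thr t → BodyStep I (c.copy m l th) t d
        (c'.copy m' l' (Function.update th t (c'.thr t)))) ∧
      c'.thr = Function.update c.thr t (c'.thr t) ∧ c'.thr t ≠ .idle ∧
      (∀ n, l' n = .retired ↔ l n = .retired) ∧
      ∀ n, l' n = .retired → c'.life n = c.life n := by
  cases hb with
  | compute o pc ρ d f ht hc =>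
    refine ⟨m, l, ⟨h.life, h.mem, h.inj⟩, fun th hth => ?_, by simp [Config.setThr],
      by simp [Config.setThr], fun _ => Iff.rfl, fun _ _ => rfl⟩
    have := BodyStep.compute (I := I) (c := c.copy m l th) o pc ρ d f (hth.trans ht) hc
    simpa [Config.setThr, Config.copy] using this
  | move o pc ρ d s f ht hc =>
    refine ⟨m, l, ⟨h.life, h.mem, h.inj⟩, fun th hth => ?_, by simp [Config.setThr],
      by simp [Config.setThr], fun _ => Iff.rfl, fun _ _ => rfl⟩
    have := BodyStep.move (I := I) (c := c.copy m l th) o pc ρ d s f (hth.trans ht) hc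
    simpa [Config.setThr, Config.copy] using this
  | choose o pc ρ d z ht hc =>
    refine ⟨m, l, ⟨h.life, h.mem, h.inj⟩, fun th hth => ?_, by simp [Config.setThr],
      by simp [Config.setThr], fun _ => Iff.rfl, fun _ _ => rfl⟩
    have := BodyStep.choose (I := I) (c := c.copy m l th) o pc ρ d z (hth.trans ht) hc
    simpa [Config.setThr, Config.copy] using this
  | jump o pc ρ f ht hc =>
    refine ⟨m, l, ⟨h.life, h.mem, h.inj⟩, fun th hth => ?_, by simp [Config.setThr],
      by simp [Config.setThr], fun _ => Iff.rfl, fun _ _ => rfl⟩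
    have := BodyStep.jump (I := I) (c := c.copy m l th) o pc ρ f (hth.trans ht) hc
    simpa [Config.setThr, Config.copy] using this
  | jumpEq o pc ρ r s q ht hc =>
    refine ⟨m, l, ⟨h.life, h.mem, h.inj⟩, fun th hth => ?_, by simp [Config.setThr],
      by simp [Config.setThr], fun _ => Iff.rfl, fun _ _ => rfl⟩
    have := BodyStep.jumpEq (I := I) (c := c.copy m l th) o pc ρ r s q (hth.trans ht) hc
    rw [h.same_eq th (fun n k => hreg _ _ _ _ n k ht) (fun n k => hreg _ _ _ _ n k ht)] at this
    simpa [Config.setThr, Config.copy] using this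
  | access o pc ρ L a cell ht hc hl =>
    have hget : ∀ th, (c.copy m l th).get cell = c.get cell := by
      intro th
      cases cell with
      | root i => rfl
      | field n i =>
        obtain ⟨r, k, hr⟩ := LocRef.resolve_eq_field hl
        exact congrFun (h.mem n (hreg _ _ _ _ _ _ ht hr)).symm i
    have hres : ∀ th, a.result (c.copy m l th).same ρ (c.get cell) =
        a.result c.same ρ (c.get cell) := by
      intro th
      refine Access.result_congr fun d e w ha => h.same_eq th (fun n k hn => ?_)
        (fun n k => hreg _ _ _ _ n k ht)
      subst ha
      exact hcas _ _ _ _ _ _ _ _ n k ht hc hl ((hget _).trans hn)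
    set w := a.result c.same ρ (c.get cell) with hw
    have hstep : ∀ th, th t = c.thr t → BodyStep I (c.copy m l th) t (L.deref ρ)
        (((c.copy m l th).set cell w).setThr t (.run o (pc + 1) (a.regs ρ (c.get cell)))) := by
      intro th hth
      have := BodyStep.access (I := I) (c := c.copy m l th) o pc ρ L a cell (hth.trans ht) hc hl
      rwa [hget, hres] at this
    cases cell with
    | root i =>
      refine ⟨m, l, ⟨h.life, h.mem, h.inj⟩, fun th hth => ?_, by simp [Config.setThr, Config.set],
        by simp [Config.setThr, Config.set], fun _ => Iff.rfl, fun _ _ => rfl⟩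
      simpa [Config.setThr, Config.set, Config.copy] using hstep th hth
    | field n i =>
      obtain ⟨r, k, hr⟩ := LocRef.resolve_eq_field hl
      have hn := hreg _ _ _ _ _ _ ht hr
      refine ⟨Function.update m n (Function.update (m n) i w), l, ⟨h.life, fun j hj => ?_, h.inj⟩,
        fun th hth => ?_, by simp [Config.setThr, Config.set],
        by simp [Config.setThr, Config.set], fun _ => Iff.rfl, fun _ _ => rfl⟩
      · change Function.update c.mem (c.addr n) _ (c.addr j) = _
        by_cases hjn : j = n
        · subst hjn
          simp [h.mem j hn]
        · have : c.addr j ≠ c.addr n := fun e => hjn (h.inj j n hj hn e)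
          simp [this, hjn, h.mem j hj]
      · simpa [Config.setThr, Config.set, Config.copy] using hstep th hth
  | alloc o pc ρ d x ht hc hx =>
    have hlf : l c.fresh = .unallocated := (hfresh _).2 le_rfl
    have hcf : c.life c.fresh = .unallocated := by
      rcases h.life c.fresh with e | e
      exacts [e.trans hlf, e.1]
    refine ⟨Function.update m c.fresh (fun _ => .val 0), Function.update l c.fresh .active,
      ⟨fun n => ?_, fun n hn => ?_, fun n k hn hk e => ?_⟩, fun th hth => ?_, by simp,
      by simp, fun n => ?_, fun n hn => ?_⟩
    · by_cases e : n = c.fresh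
      · simp [e]
      · simpa [e] using h.life n
    · by_cases e : n = c.fresh
      · simp [e]
      · simp only [Function.update_of_ne e] at hn ⊢
        simp [hx n hn, h.mem n hn]
    · by_cases e1 : n = c.fresh <;> by_cases e2 : k = c.fresh
      · rw [e1, e2]
      · subst e1
        simp only [Function.update_of_ne e2, Function.update_self] at hk e
        exact absurd e.symm (hx k hk)
      · subst e2
        simp only [Function.update_of_ne e1, Function.update_self] at hn e
        exact absurd e (hx n hn)
      · simp only [Function.update_of_ne e1, Function.update_of_ne e2] at hn hk e
        exact h.inj n k hn hk e
    · have := BodyStep.alloc (I := I) (c := c.copy m l th) o pc ρ d c.fresh (hth.trans ht) hc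
        (fun n hn e => hn ((hfresh n).2 (le_of_eq e.symm)))
      have hid : Function.update (id : ℕ → ℕ) c.fresh c.fresh = id := Function.update_eq_self _ _
      simpa [Config.copy, hid] using this
    · by_cases e : n = c.fresh
      · simp [e, hlf]
      · simp [e]
    · by_cases e : n = c.fresh
      · simp [e] at hn
      · simp [e]

/-! ### Epochs -/

/-- The thread has invoked an operation and is still executing `begin_op`. -/
def Phase.IsPrelude : Phase → Prop
  | .beginRead | .announce _ | .reclaim _ | .scan _ _ => True
  | _ => False

/-- The announcement of the thread is in force: it is between the announcement in `begin_op` and the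
beginning of `end_op`. -/
def Phase.IsGuarded : Phase → Prop
  | .reclaim _ | .scan _ _ | .body | .insert _ _ => True
  | _ => False

/-- Invariant of the epoch counter. `base t` is the epoch at the time of the last announcement of `t`;
it may exceed the announced epoch, which was read earlier. A scan for epoch `e` that has passed a
guarded thread `u` has `e ≤ base u`: either `u` announced after the check, or the check found `e`
announced. Hence the counter cannot exceed `base u + 1` as long as `u` is guarded. -/
structure EBRConf.EpochInv (s : EBRConf N Op) (base : Fin N → ℕ) : Prop where
  base_le : ∀ t, base t ≤ s.epoch
  guarded : ∀ t, (s.phase t).IsGuarded →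
    s.epoch ≤ base t + 1 ∧ ∃ a, s.ann t = some a ∧ a ≤ base t
  announce : ∀ t e, s.phase t = .announce e → e ≤ s.epoch
  reclaim : ∀ t e, s.phase t = .reclaim e → e ≤ s.epoch
  scan : ∀ t e k, s.phase t = .scan e k → e ≤ s.epoch ∧
    ∀ u : Fin N, u < k → (s.phase u).IsGuarded → e ≤ base u

/-- Preservation under a step of `t` that leaves the counter and the other threads unchanged. -/
theorem EBRConf.EpochInv.update {s s' : EBRConf N Op} {base base' : Fin N → ℕ}
    (h : s.EpochInv base) (t : Fin N) (hep : s'.epoch = s.epoch)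
    (hph : ∀ u, u ≠ t → s'.phase u = s.phase u) (hann : ∀ u, u ≠ t → s'.ann u = s.ann u)
    (hbase : ∀ u, u ≠ t → base' u = base u) (hle : base t ≤ base' t ∧ base' t ≤ s.epoch)
    (hguard : (s'.phase t).IsGuarded → ((s.phase t).IsGuarded ∨ base' t = s.epoch) ∧
      s.epoch ≤ base' t + 1 ∧ ∃ a, s'.ann t = some a ∧ a ≤ base' t)
    (hannounce : ∀ e, s'.phase t = .announce e → e ≤ s.epoch)
    (hreclaim : ∀ e, s'.phase t = .reclaim e → e ≤ s.epoch)
    (hscan : ∀ e k, s'.phase t = .scan e k → e ≤ s.epoch ∧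
      ∀ u : Fin N, u < k → (s'.phase u).IsGuarded → e ≤ base' u) :
    s'.EpochInv base' := by
  refine ⟨fun u => ?_, fun u hu => ?_, fun u e he => ?_, fun u e he => ?_, fun u e k he => ?_⟩ <;>
    rw [hep] <;> rcases eq_or_ne u t with rfl | hut
  · exact hle.2
  · rw [hbase u hut]
    exact h.base_le u
  · exact (hguard hu).2
  · rw [hbase u hut, hann u hut]
    rw [hph u hut] at hu
    exact h.guarded u hu
  · exact hannounce e he
  · rw [hph u hut] at he
    exact h.announce u e he
  · exact hreclaim e he
  · rw [hph u hut] at he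
    exact h.reclaim u e he
  · exact hscan e k he
  · rw [hph u hut] at he
    obtain ⟨h1, h2⟩ := h.scan u e k he
    refine ⟨h1, fun v hv hg => ?_⟩
    rcases eq_or_ne v t with rfl | hvt
    · rcases (hguard hg).1 with h3 | h3
      · exact (h2 v hv h3).trans hle.1
      · omega
    · rw [hbase v hvt]
      rw [hph v hvt] at hg
      exact h2 v hv hg

/-- `base` changes only for a thread that is in `begin_op`. -/
theorem EBRConf.EpochInv.step {I : Impl N Op} {s s' : EBRConf N Op} {l : Label N Op}
    {base : Fin N → ℕ} (h : s.EpochInv base) (hs : EBRStep I s l s') :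
    ∃ base', s'.EpochInv base' ∧ ∀ t, ¬ (s'.phase t).IsPrelude → base' t = base t := by
  have hb := h.base_le
  cases hs with
  | announce t e hp =>
    refine ⟨Function.update base t s.epoch, h.update t rfl ?_ ?_ ?_ ?_ ?_ ?_ ?_ ?_, fun u hu => ?_⟩
    all_goals try simp +contextual only [EBRConf.setPhase, Function.update_self, ne_eq,
      Function.update_of_ne, not_false_eq_true, implies_true, le_refl, reduceCtorEq,
      false_implies, and_true]
    · exact hb t
    · exact fun _ => ⟨.inr trivial, by omega, e, rfl, h.announce t e hp⟩
    · rintro e' ⟨⟩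
      exact h.announce t e hp
    · rcases eq_or_ne u t with rfl | hut
      · simp [EBRConf.setPhase, Phase.IsPrelude] at hu
      · simp [hut]
  | scanNext t e u hp hann =>
    have ht : (s.phase t).IsGuarded := by rw [hp]; trivial
    refine ⟨base, h.update t rfl ?_ (by simp [EBRConf.setPhase]) (by simp) ⟨le_rfl, hb t⟩
      (fun _ => ⟨.inl ht, h.guarded t ht⟩) ?_ ?_ ?_, fun _ _ => rfl⟩
    all_goals simp +contextual only [EBRConf.setPhase, Function.update_self, ne_eq,
      Function.update_of_ne, not_false_eq_true, implies_true, reduceCtorEq, false_implies]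
    rintro e' k ⟨⟩
    obtain ⟨h1, h2⟩ := h.scan t e u hp
    refine ⟨h1, fun v hv hg => ?_⟩
    have hg' : (s.phase v).IsGuarded := by
      rcases eq_or_ne v t with rfl | hvt
      · exact ht
      · simpa [hvt] using hg
    rcases Nat.lt_succ_iff_lt_or_eq.1 hv with hv | hv
    · exact h2 v hv hg'
    · obtain rfl := Fin.ext hv
      obtain ⟨-, a, ha, hab⟩ := h.guarded v hg'
      rcases hann with h3 | h3
      · simp [ha] at h3
      · simp only [ha, Option.some.injEq] at h3
        omega
  | advance t e hp =>
    -- The scan has passed all threads, so every guarded thread `u` has `e ≤ base u`.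
    obtain ⟨h1, h2⟩ := h.scan t e N hp
    have ht : (s.phase t).IsGuarded := by rw [hp]; trivial
    have h0 : (s.setPhase t .body).EpochInv base := by
      refine h.update t rfl ?_ (by simp [EBRConf.setPhase]) (by simp) ⟨le_rfl, hb t⟩
        (fun _ => ⟨.inl ht, h.guarded t ht⟩) ?_ ?_ ?_
      all_goals simp +contextual only [EBRConf.setPhase, Function.update_self, ne_eq,
        Function.update_of_ne, not_false_eq_true, implies_true, reduceCtorEq, false_implies]
    refine ⟨base, ?_, fun _ _ => rfl⟩
    have hle : s.epoch ≤ if s.epoch = e then e + 1 else s.epoch := by split_ifs <;> omega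
    refine ⟨fun u => (h0.base_le u).trans hle, fun u hu => ⟨?_, (h0.guarded u hu).2⟩,
      fun u e he => (h0.announce u e he).trans hle, fun u e he => (h0.reclaim u e he).trans hle,
      fun u e k he => ⟨(h0.scan u e k he).1.trans hle, (h0.scan u e k he).2⟩⟩
    have hu' : (s.phase u).IsGuarded := by
      rcases eq_or_ne u t with rfl | hut
      · exact ht
      · simpa [hut, EBRConf.setPhase] using hu
    have h3 := h2 u u.2 hu'
    have h4 := (h.guarded u hu').1
    change (if s.epoch = e then e + 1 else s.epoch) ≤ base u + 1
    split_ifs <;> omega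
  | reclaimDone t e hp =>
    have ht : (s.phase t).IsGuarded := by rw [hp]; trivial
    refine ⟨base, h.update t rfl ?_ (by simp [EBRConf.setPhase]) (by simp) ⟨le_rfl, hb t⟩
      (fun _ => ⟨.inl ht, h.guarded t ht⟩) ?_ ?_ ?_, fun _ _ => rfl⟩
    all_goals simp +contextual only [EBRConf.setPhase, Function.update_self, ne_eq,
      Function.update_of_ne, not_false_eq_true, implies_true, reduceCtorEq, false_implies]
    rintro e' k ⟨⟩
    exact ⟨h.reclaim t e hp, fun u hu => absurd hu (Nat.not_lt_zero _)⟩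
  | invoke t o c' hp | read t hp | endOp t v c' hp | ret t v c' hp =>
    refine ⟨base, h.update t rfl ?_ ?_ (by simp) ⟨le_rfl, hb t⟩ ?_ ?_ ?_ ?_, fun _ _ => rfl⟩
    all_goals simp +contextual [EBRConf.setPhase, Phase.IsGuarded]
  | body t d c' hp =>
    exact ⟨base, ⟨h.base_le, h.guarded, h.announce, h.reclaim, h.scan⟩, fun _ _ => rfl⟩
  | reclaim t e n l hp =>
    exact ⟨base, ⟨h.base_le, h.guarded, h.announce, h.reclaim, h.scan⟩, fun _ _ => rfl⟩
  | scanFail t _ _ hp | retire t _ _ hp | insert t _ _ hp =>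
    have ht : (s.phase t).IsGuarded := by rw [hp]; trivial
    refine ⟨base, h.update t rfl ?_ (by simp [EBRConf.setPhase, EBRConf.setList]) (by simp)
      ⟨le_rfl, hb t⟩ (fun _ => ⟨.inl ht, h.guarded t ht⟩) ?_ ?_ ?_, fun _ _ => rfl⟩
    all_goals simp +contextual [EBRConf.setPhase, EBRConf.setList]

/-- Invariant of the retire lists; `ret n` is the epoch in which `n` was retired. List number `k`
holds nodes retired in epochs congruent to `k` modulo 3, and when its owner is about to reclaim with
epoch `e`, none of them was retired after epoch `e`. -/
structure EBRConf.ListInv (s : EBRConf N Op) (life : ℕ → Life) (ret : ℕ → ℕ) : Prop where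
  mem_list : ∀ u k n, n ∈ s.lists u k → life n = .retired ∧ ret n % 3 = k ∧ ret n ≤ s.epoch
  bound : ∀ u e k n, s.phase u = .announce e ∨ s.phase u = .reclaim e → n ∈ s.lists u k →
    ret n ≤ e
  insert : ∀ u n e, s.phase u = .insert n e → life n = .retired ∧ ret n = e ∧ e ≤ s.epoch

theorem EBRStep.epoch_le {I : Impl N Op} {s s' : EBRConf N Op} {l : Label N Op}
    (hs : EBRStep I s l s') : s.epoch ≤ s'.epoch := by
  cases hs with
  | advance t e hp =>
    change s.epoch ≤ if s.epoch = e then e + 1 else s.epoch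
    split_ifs <;> omega
  | _ => exact le_rfl

theorem EBRConf.ListInv.step {I : Impl N Op} {s s' : EBRConf N Op} {l : Label N Op}
    {life life' : ℕ → Life} {ret ret' : ℕ → ℕ} (h : s.ListInv life ret) (hs : EBRStep I s l s')
    (hlife : ∀ n, life n = .retired → life' n = .retired)
    (hret : ∀ n, life n = .retired → ret' n = ret n)
    (hnew : ∀ t n e, s.phase t = .body → s'.phase t = .insert n e →
      life' n = .retired ∧ ret' n = e ∧ e ≤ s.epoch) :
    s'.ListInv life' ret' := by
  have hep := hs.epoch_le
  have h1 : ∀ u k n, n ∈ s.lists u k → life' n = .retired ∧ ret' n % 3 = k ∧ ret' n ≤ s'.epoch :=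
    fun u k n hn => by
      obtain ⟨h1, h2, h3⟩ := h.mem_list u k n hn
      exact ⟨hlife n h1, hret n h1 ▸ h2, hret n h1 ▸ h3.trans hep⟩
  have h2 : ∀ u e k n, s.phase u = .announce e ∨ s.phase u = .reclaim e → n ∈ s.lists u k →
      ret' n ≤ e := fun u e k n hp hn => by
    rw [hret n (h.mem_list u k n hn).1]
    exact h.bound u e k n hp hn
  have h3 : ∀ u n e, s.phase u = .insert n e → life' n = .retired ∧ ret' n = e ∧ e ≤ s'.epoch :=
    fun u n e hp => by
      obtain ⟨h1, h2, h3⟩ := h.insert u n e hp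
      exact ⟨hlife n h1, hret n h1 ▸ h2, h3.trans hep⟩
  have h4 : ∀ u k n, n ∈ s.lists u k → ret' n ≤ s.epoch := fun u k n hn => by
    obtain ⟨h1, h2, h3⟩ := h.mem_list u k n hn
    exact hret n h1 ▸ h3
  clear h hlife hret
  cases hs with
  | reclaim t e n l hp hl =>
    have hsub : ∀ u k i, i ∈ Function.update s.lists t
        (Function.update (s.lists t) (Fin.ofNat 3 (e + 1)) l) u k → i ∈ s.lists u k := by
      intro u k i hi
      simp only [Function.update_apply] at hi
      split_ifs at hi with hu
      · subst hu
        simp only [Function.update_apply] at hi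
        split_ifs at hi with hk
        · rw [hk, hl]
          exact List.mem_cons_of_mem _ hi
        · exact hi
      · exact hi
    exact ⟨fun u k i hi => h1 u k i (hsub u k i hi),
      fun u e k i hp hi => h2 u e k i hp (hsub u k i hi),
      h3⟩
  | insert t n e hp =>
    obtain ⟨h5, h6, h7⟩ := h3 t n e hp
    have hsub : ∀ u k i, i ∈ Function.update s.lists t
        (Function.update (s.lists t) (Fin.ofNat 3 e) (n :: s.lists t (Fin.ofNat 3 e))) u k →
        i ∈ s.lists u k ∨ i = n ∧ k = Fin.ofNat 3 e ∧ u = t := by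
      intro u k i hi
      simp only [Function.update_apply] at hi
      split_ifs at hi with hu
      · subst hu
        simp only [Function.update_apply] at hi
        split_ifs at hi with hk
        · subst hk
          rcases List.mem_cons.1 hi with hi | hi
          exacts [.inr ⟨hi, rfl, rfl⟩, .inl hi]
        · exact .inl hi
      · exact .inl hi
    refine ⟨fun u k i hi => ?_, fun u e' k i hp' hi => ?_, fun u i e' hp' => ?_⟩
    · rcases hsub u k i hi with hi | ⟨rfl, rfl, -⟩
      exacts [h1 u k i hi, ⟨h5, by rw [h6]; rfl, h6 ▸ h7⟩]
    · simp only [EBRConf.setPhase, EBRConf.setList, Function.update_apply] at hp'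
      split_ifs at hp' with hu
      · simp at hp'
      · rcases hsub u k i hi with hi | ⟨-, -, rfl⟩
        exacts [h2 u e' k i hp' hi, absurd rfl hu]
    · simp only [EBRConf.setPhase, EBRConf.setList, Function.update_apply] at hp'
      split_ifs at hp'
      exact h3 u i e' hp'
  | body t d c' hp hb => exact ⟨h1, h2, h3⟩
  | read t hp =>
    refine ⟨h1, fun u e' k i hp' hi => ?_, fun u i e' hp' => ?_⟩ <;>
      simp only [EBRConf.setPhase, Function.update_apply] at hp' <;> split_ifs at hp' with hu
    · rcases hp' with ⟨⟨⟩⟩ | ⟨⟨⟩⟩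
      exact h4 u k i hi
    · exact h2 u e' k i hp' hi
    · exact h3 u i e' hp'
  | announce t e hp =>
    refine ⟨h1, fun u e' k i hp' hi => ?_, fun u i e' hp' => ?_⟩ <;>
      simp only [EBRConf.setPhase, Function.update_apply] at hp' <;> split_ifs at hp' with hu
    · rcases hp' with ⟨⟨⟩⟩ | ⟨⟨⟩⟩
      exact h2 u e k i (.inl (hu ▸ hp)) hi
    · exact h2 u e' k i hp' hi
    · exact h3 u i e' hp'
  | retire t n c' hp hr =>
    refine ⟨h1, fun u e' k i hp' hi => ?_, fun u i e' hp' => ?_⟩ <;> have hp'' := hp' <;>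
      simp only [EBRConf.setPhase, Function.update_apply] at hp' <;> split_ifs at hp' with hu
    · simp at hp'
    · exact h2 u e' k i hp' hi
    · exact hnew u i e' (hu ▸ hp) hp''
    · exact h3 u i e' hp'
  | _ =>
    refine ⟨h1, fun u e' k i hp' hi => ?_, fun u i e' hp' => ?_⟩ <;>
      simp only [EBRConf.setPhase, Function.update_apply] at hp' <;> split_ifs at hp'
    · simp at hp'
    · exact h2 u e' k i hp' hi
    · exact h3 u i e' hp'

/-- The state of the program in the phases in which it is determined by the phase; in particular,
local variables hold no pointers during `begin_op`. -/
structure EBRConf.ThrInv (s : EBRConf N Op) : Prop where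
  out : ∀ t, s.phase t = .out → s.core.thr t = .idle
  prelude : ∀ t, (s.phase t).IsPrelude → ∃ o, s.core.thr t = .run o 0 fun _ => .val 0

theorem BodyStep.thr_of_ne {I : Impl N Op} {c c' : Config N Op} {t u : Fin N} {d}
    (h : BodyStep I c t d c') (hu : u ≠ t) : c'.thr u = c.thr u := by
  cases h with
  | access o pc ρ l a cell => cases cell <;> simp [Config.setThr, Config.set, hu]
  | _ => simp [Config.setThr, hu]

theorem EBRConf.ThrInv.update {s s' : EBRConf N Op} (h : s.ThrInv) (t : Fin N)
    (hph : ∀ u, u ≠ t → s'.phase u = s.phase u) (hthr : ∀ u, u ≠ t → s'.core.thr u = s.core.thr u)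
    (hout : s'.phase t = .out → s'.core.thr t = .idle)
    (hpre : (s'.phase t).IsPrelude → ∃ o, s'.core.thr t = .run o 0 fun _ => .val 0) :
    s'.ThrInv := by
  refine ⟨fun u hu => ?_, fun u hu => ?_⟩ <;> rcases eq_or_ne u t with rfl | hut
  · exact hout hu
  · rw [hthr u hut]
    exact h.out u (hph u hut ▸ hu)
  · exact hpre hu
  · rw [hthr u hut]
    exact h.prelude u (hph u hut ▸ hu)

theorem EBRConf.ThrInv.step {I : Impl N Op} {s s' : EBRConf N Op} {l : Label N Op}
    (h : s.ThrInv) (hs : EBRStep I s l s') : s'.ThrInv := by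
  cases hs with
  | invoke t o c' hp hi =>
    obtain ⟨-, rfl⟩ := hi
    refine h.update t ?_ ?_ ?_ ?_ <;> simp +contextual [EBRConf.setPhase, Config.setThr]
  | ret t v c' hp hi =>
    obtain ⟨_, _, _, _, -, -, -, rfl⟩ := hi
    refine h.update t ?_ ?_ ?_ ?_ <;>
      simp +contextual [EBRConf.setPhase, Config.setThr, Phase.IsPrelude]
  | retire t n c' hp hi =>
    obtain ⟨_, _, _, _, _, -, -, -, rfl⟩ := hi
    refine h.update t ?_ ?_ ?_ ?_ <;> simp +contextual [EBRConf.setPhase, Phase.IsPrelude]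
  | body t d c' hp hi =>
    refine h.update t (fun _ _ => rfl) (fun u hu => hi.thr_of_ne hu) ?_ ?_ <;>
      simp [hp, Phase.IsPrelude]
  | reclaim t e n l hp => exact ⟨h.out, h.prelude⟩
  | read t hp | announce t _ hp | reclaimDone t _ hp | scanNext t _ _ hp =>
    have ht := h.prelude t (by rw [hp]; trivial)
    refine h.update t ?_ (fun _ _ => rfl) ?_ (fun _ => ht) <;> simp +contextual [EBRConf.setPhase]
  | scanFail t _ _ hp | advance t _ hp | insert t _ _ hp | endOp t _ _ hp =>
    refine h.update t ?_ (fun _ _ => rfl) ?_ ?_ <;>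
      simp +contextual [EBRConf.setPhase, EBRConf.setList, Phase.IsPrelude]

/-! ### Simulation by plain executions -/

/-- The threads as they would be if every operation were invoked only at the end of `begin_op`. -/
noncomputable def EBRConf.delayed (s : EBRConf N Op) : Fin N → Thread Op := fun t =>
  open Classical in if (s.phase t).IsPrelude then .idle else s.core.thr t

/-- Auxiliary state attached to a configuration of the integrated implementation: memory and life-cycle
states of the run without reclamation, the epoch `base t` at the last announcement of `t`, the epoch
`ret n` in which `n` was retired, and the nodes `seen t` that were not yet retired at some time
between the end of `begin_op` and now in the current operation of `t`. -/
structure Ghost (N : ℕ) where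
  mem : ℕ → ℕ → Word
  life : ℕ → Life
  base : Fin N → ℕ
  ret : ℕ → ℕ
  seen : Fin N → ℕ → Prop

/-- The simulation invariant. `reach` concerns the plain run with delayed invocations: with the actual
invocation times, a node could be in the scope of an operation although it was retired before the
announcement. A reclaimed node was retired at least two epochs ago (`reclaimed`), whereas a node that
was retired in the course of an operation was retired after its announcement (`base_le_ret`). -/
structure EBRConf.Simulated (I : Impl N Op) (s : EBRConf N Op) (g : Ghost N) : Prop where
  reach : PlainReach I (s.core.copy g.mem g.life s.delayed) g.seen
  mirrors : s.core.Mirrors g.mem g.life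
  reclaimed : ∀ n, g.life n = .retired → s.core.life n = .unallocated → g.ret n + 2 ≤ s.epoch
  epochs : s.EpochInv g.base
  lists : s.ListInv g.life g.ret
  base_le_ret : ∀ t n, g.seen t n → g.life n = .retired → g.base t ≤ g.ret n
  thr : s.ThrInv

namespace EBRConf.Simulated

variable {I : Impl N Op} {s s' : EBRConf N Op} {g : Ghost N}

theorem start (I : Impl N Op) : ∃ g, (ebr N Op I).start.Simulated I g ∧
    (ebr N Op I).start.core.copy g.mem g.life (ebr N Op I).start.core.thr = I.initial := by
  refine ⟨⟨I.initMem, I.initial.life, fun _ => 0, fun _ => 0, fun _ _ => False⟩,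
    ⟨?_, ?_, ?_, ?_, ?_, ?_, ?_⟩, rfl⟩
  · have : (ebr N Op I).start.core.copy I.initMem I.initial.life (ebr N Op I).start.delayed =
        I.initial := by
      simp [Config.copy, Impl.initial, funext_iff, EBRConf.delayed, Phase.IsPrelude]
    rw [this]
    exact .start
  · exact ⟨fun n => .inl rfl, fun n _ => rfl, fun n k _ _ h => h⟩
  · intro n hn hn'
    exact absurd (hn.symm.trans hn') (by simp)
  · constructor <;> simp [Phase.IsGuarded]
  · constructor <;> simp
  · exact fun _ _ h => h.elim
  · constructor <;> simp [Phase.IsPrelude, Impl.initial]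

/-- Preservation of the invariant, given the memory, life-cycle states and retirement epochs after
the step, for a step that is a step or nothing at all in the plain run with delayed invocations. -/
theorem next (h : s.Simulated I g) {l : Label N Op} (hs : EBRStep I s l s')
    (m : ℕ → ℕ → Word) (life : ℕ → Life) (ret : ℕ → ℕ)
    (hreach : s'.core.copy m life s'.delayed = s.core.copy g.mem g.life s.delayed ∨
      ∃ l', PlainStep I (s.core.copy g.mem g.life s.delayed) l' (s'.core.copy m life s'.delayed))
    (hmir : s'.core.Mirrors m life)
    (hlife : ∀ n, g.life n = .retired → life n = .retired)
    (hret : ∀ n, g.life n = .retired → ret n = g.ret n)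
    (hnew : ∀ n, life n = .retired → g.life n ≠ .retired →
      ret n = s.epoch ∧ s'.core.life n ≠ .unallocated)
    (hrec : ∀ n, g.life n = .retired → s'.core.life n = .unallocated →
      s.core.life n = .unallocated ∨ g.ret n + 2 ≤ s.epoch)
    (hins : ∀ t n e, s.phase t = .body → s'.phase t = .insert n e →
      life n = .retired ∧ ret n = e ∧ e ≤ s.epoch) :
    ∃ g', s'.Simulated I g' ∧ g'.mem = m ∧ g'.life = life := by
  obtain ⟨base, hbase, hbeq⟩ := h.epochs.step hs
  obtain ⟨seen, hseen, hsub⟩ : ∃ seen, PlainReach I (s'.core.copy m life s'.delayed) seen ∧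
      ∀ t n, seen t n → g.seen t n ∨ life n ≠ .retired := by
    rcases hreach with e | ⟨l', hl⟩
    · exact ⟨g.seen, e ▸ h.reach, fun t n => .inl⟩
    · exact ⟨_, h.reach.step _ _ _ _ hl, fun t n hn => hn.2⟩
  refine ⟨⟨m, life, base, ret, seen⟩, ⟨hseen, hmir, fun n hn hn' => ?_, hbase,
    h.lists.step hs hlife hret hins, fun t n hn hr => ?_, h.thr.step hs⟩, rfl, rfl⟩
  · by_cases hg : g.life n = .retired
    · refine le_trans ?_ hs.epoch_le
      change ret n + 2 ≤ s.epoch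
      rw [hret n hg]
      exact (hrec n hg hn').elim (h.reclaimed n hg) id
    · exact absurd hn' (hnew n hn hg).2
  · have ht : ¬ (s'.phase t).IsPrelude := fun hp =>
      hseen.thr_ne_idle hn (by simp [Config.copy, EBRConf.delayed, hp])
    change base t ≤ ret n
    rw [hbeq t ht]
    by_cases hg : g.life n = .retired
    · rw [hret n hg]
      exact h.base_le_ret t n ((hsub t n hn).resolve_right (fun h => h hr)) hg
    -- A node retired in this step is retired in the current epoch.
    · rw [(hnew n hr hg).1]
      exact h.epochs.base_le t

/-- The core of the argument: if `n` was reclaimed, then `ret n + 2 ≤ epoch ≤ base t + 1`, but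
`base t ≤ ret n` if `n` was retired in the course of the operation of `t`. -/
theorem not_reclaimed (h : s.Simulated I g) {t : Fin N} {n : ℕ} (ht : s.phase t = .body)
    (hn : g.life n = .retired → g.seen t n) (hlt : n < s.core.fresh) :
    s.core.life n ≠ .unallocated := by
  intro hu
  rcases h.mirrors.life n with e | ⟨-, e⟩
  · have : s.core.fresh ≤ n := (h.reach.wellFormed.life n).1 (e.symm.trans hu)
    omega
  · have h1 := h.reclaimed n e hu
    have h2 := h.base_le_ret t n (hn e) e
    have h3 := (h.epochs.guarded t (by rw [ht]; trivial)).1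
    omega

theorem delayed_of_body {t : Fin N} (ht : s.phase t = .body) : s.delayed t = s.core.thr t := by
  simp [EBRConf.delayed, ht, Phase.IsPrelude]

theorem reg_not_reclaimed (hI : IsPlain I) (h : s.Simulated I g) {t : Fin N}
    (hp : s.phase t = .body) {o pc ρ r n k} (ht : s.core.thr t = .run o pc ρ)
    (hr : ρ r = .ptr n k) : s.core.life n ≠ .unallocated := by
  have ht' := (delayed_of_body hp).trans ht
  exact h.not_reclaimed hp (fun _ => h.reach.seen_of_reg hI ht' hr)
    (h.reach.wellFormed.regs _ _ _ _ _ _ _ ht' hr)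

/-- The compared content of the cell is delivered into a local variable, so it is in the scope of the
operation in the configuration after the plain step. This excludes the ABA problem. -/
theorem cas_not_reclaimed (hI : IsPlain I) (h : s.Simulated I g) {t : Fin N}
    (hp : s.phase t = .body) {o pc ρ L d e w cell n k} (ht : s.core.thr t = .run o pc ρ)
    (hc : I.code t o pc = .access L (.cas d e w)) (hL : L.resolve ρ = some cell)
    (hr : (s.core.copy g.mem g.life s.core.thr).get cell = .ptr n k) :
    s.core.life n ≠ .unallocated := by
  have ht' := (delayed_of_body hp).trans ht
  have hr' : (s.core.copy g.mem g.life s.delayed).get cell = .ptr n k := by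
    rw [← hr]
    cases cell <;> rfl
  have hb := BodyStep.access (I := I) (c := s.core.copy g.mem g.life s.delayed) o pc ρ L _ cell
    ht' hc hL
  have hreach := h.reach.step _ _ _ _ (.body _ _ _ _ hb)
  have hd : (Access.cas d e w).regs ρ ((s.core.copy g.mem g.life s.delayed).get cell) d
      = .ptr n k := by
    simp [Access.regs, hr']
  have hseen := hreach.seen_of_reg hI (t := t) (Function.update_self _ _ _) hd
  refine h.not_reclaimed hp (fun hn => ?_) (h.reach.wellFormed.get hr')
  refine hseen.2.resolve_right (fun hne => hne ?_)
  rw [← hn]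
  cases cell <;> rfl

end EBRConf.Simulated

/-- A bound on the number of steps that `t` performs, all of them in the code of EBR, before its next
step that is also a step of the plain implementation. -/
def EBRConf.overhead (s : EBRConf N Op) (t : Fin N) : ℕ :=
  match s.phase t with
  | .beginRead => (∑ k, (s.lists t k).length) + N + 5
  | .announce _ => (∑ k, (s.lists t k).length) + N + 4
  | .reclaim _ => (∑ k, (s.lists t k).length) + N + 3
  | .scan _ k => N - k + 2
  | .insert _ _ => 2
  | .body => 1
  | .out | .ended => 0

theorem EBRStep.overhead_of_ne {I : Impl N Op} {s s' : EBRConf N Op} {l : Label N Op}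
    (hs : EBRStep I s l s') {u : Fin N} (hu : u ≠ l.tid) : s'.overhead u = s.overhead u := by
  cases hs <;> simp_all [EBRConf.overhead, EBRConf.setPhase, EBRConf.setList]

theorem EBRConf.delayed_of_prelude {s : EBRConf N Op} {t : Fin N} (h : (s.phase t).IsPrelude) :
    s.delayed t = .idle := if_pos h

theorem EBRConf.delayed_of_not_prelude {s : EBRConf N Op} {t : Fin N}
    (h : ¬ (s.phase t).IsPrelude) : s.delayed t = s.core.thr t := if_neg h

theorem EBRConf.delayed_eq_update {s s' : EBRConf N Op} (t : Fin N) {x : Thread Op}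
    (hph : ∀ u, u ≠ t → s'.phase u = s.phase u) (hthr : ∀ u, u ≠ t → s'.core.thr u = s.core.thr u)
    (hx : s'.delayed t = x) : s'.delayed = Function.update s.delayed t x := by
  ext u
  rcases eq_or_ne u t with rfl | hut
  · simpa using hx
  · rw [Function.update_of_ne hut, EBRConf.delayed, EBRConf.delayed, hph u hut, hthr u hut]

theorem EBRConf.delayed_eq {s s' : EBRConf N Op} (t : Fin N)
    (hph : ∀ u, u ≠ t → s'.phase u = s.phase u) (hthr : ∀ u, u ≠ t → s'.core.thr u = s.core.thr u)
    (ht : s'.delayed t = s.delayed t) : s'.delayed = s.delayed :=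
  (EBRConf.delayed_eq_update t hph hthr ht).trans (Function.update_eq_self _ _)

namespace EBRConf.Simulated

variable {I : Impl N Op} {s s' : EBRConf N Op} {g : Ghost N}

/-- `next` for steps that retire no node and change neither memory nor life-cycle states of the plain run. -/
theorem quiet (h : s.Simulated I g) {l : Label N Op} (hs : EBRStep I s l s')
    (hreach : s'.core.copy g.mem g.life s'.delayed = s.core.copy g.mem g.life s.delayed ∨
      ∃ l', PlainStep I (s.core.copy g.mem g.life s.delayed) l'
        (s'.core.copy g.mem g.life s'.delayed))
    (hmir : s'.core.Mirrors g.mem g.life)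
    (hrec : ∀ n, g.life n = .retired → s'.core.life n = .unallocated →
      s.core.life n = .unallocated ∨ g.ret n + 2 ≤ s.epoch)
    (hins : ∀ t n e, s.phase t = .body → s'.phase t ≠ .insert n e) :
    ∃ g', s'.Simulated I g' ∧ g'.mem = g.mem ∧ g'.life = g.life :=
  h.next hs g.mem g.life g.ret hreach hmir (fun _ => id) (fun _ _ => rfl)
    (fun _ h1 h2 => absurd h1 h2) hrec fun t n e h1 h2 => absurd h2 (hins t n e h1)

/-- Every step preserves the invariant, and in the plain run in which operations start when they are
invoked, it is either the same step, or nothing, while the overhead of its thread decreases. -/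
theorem step (hI : IsPlain I) (h : s.Simulated I g) {l : Label N Op} (hs : EBRStep I s l s') :
    ∃ g', s'.Simulated I g' ∧
      (PlainStep I (s.core.copy g.mem g.life s.core.thr) l
          (s'.core.copy g'.mem g'.life s'.core.thr) ∨
        l.ev = none ∧
          s'.core.copy g'.mem g'.life s'.core.thr = s.core.copy g.mem g.life s.core.thr ∧
          s'.overhead l.tid < s.overhead l.tid) := by
  have hs0 := hs
  cases hs with
  | invoke t o c' hp hi =>
    obtain ⟨hidle, rfl⟩ := hi
    refine Exists.elim (h.quiet hs0 (.inl ?_) ⟨h.mirrors.1, h.mirrors.2, h.mirrors.3⟩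
      (fun n _ hn => .inl hn) ?_) ?_
    · refine congrArg (s.core.copy g.mem g.life) (EBRConf.delayed_eq t ?_ ?_ ?_)
      · simp +contextual [EBRConf.setPhase]
      · simp +contextual [EBRConf.setPhase, Config.setThr]
      · rw [EBRConf.delayed_of_prelude (by simp [EBRConf.setPhase, Phase.IsPrelude]),
          EBRConf.delayed_of_not_prelude (by simp [hp, Phase.IsPrelude]), hidle]
    · intro u n e hu
      simp only [EBRConf.setPhase, Function.update_apply]
      split_ifs <;> simp [hu]
    · rintro g' ⟨hg, hm, hl⟩
      refine ⟨g', hg, .inl ?_⟩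
      rw [hm, hl]
      exact .invoke _ _ _ _ ⟨hidle, rfl⟩
  | ret t v c' hp hi =>
    obtain ⟨o, pc, ρ, r, ht, hc, hv, rfl⟩ := hi
    refine Exists.elim (h.quiet hs0 (.inr ⟨⟨t, some (.res v), none⟩, ?_⟩)
      ⟨h.mirrors.1, h.mirrors.2, h.mirrors.3⟩ (fun n _ hn => .inl hn) ?_) ?_
    · refine .ret _ _ _ _ ⟨o, pc, ρ, r, ?_, hc, hv, ?_⟩
      · simp [Config.copy, EBRConf.delayed, hp, Phase.IsPrelude, ht]
      · refine congrArg (s.core.copy g.mem g.life) (EBRConf.delayed_eq_update t ?_ ?_ ?_)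
        · simp +contextual [EBRConf.setPhase]
        · simp +contextual [EBRConf.setPhase, Config.setThr]
        · simp [EBRConf.delayed, EBRConf.setPhase, Config.setThr, Phase.IsPrelude]
    · intro u n e hu
      simp only [EBRConf.setPhase, Function.update_apply]
      split_ifs <;> simp [hu]
    · rintro g' ⟨hg, hm, hl⟩
      refine ⟨g', hg, .inl ?_⟩
      rw [hm, hl]
      exact .ret _ _ _ _ ⟨o, pc, ρ, r, ht, hc, hv, rfl⟩
  | read t hp | announce t e hp | reclaimDone t e hp | scanNext t e u hp =>
    refine Exists.elim (h.quiet hs0 (.inl ?_) h.mirrors (fun n _ hn => .inl hn) ?_) ?_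
    · refine congrArg (s.core.copy g.mem g.life) (EBRConf.delayed_eq t ?_
        (fun _ _ => rfl) ?_)
      · simp +contextual [EBRConf.setPhase]
      · simp [EBRConf.delayed, EBRConf.setPhase, hp, Phase.IsPrelude]
    · intro v n e hv
      simp only [EBRConf.setPhase, Function.update_apply]
      split_ifs <;> simp [hv]
    · rintro g' ⟨hg, hm, hl⟩
      refine ⟨g', hg, .inr ⟨rfl, by rw [hm, hl]; rfl, ?_⟩⟩
      simp [EBRConf.overhead, EBRConf.setPhase, hp]
      try omega
  | insert t n e hp | endOp t v c' hp =>
    refine Exists.elim (h.quiet hs0 (.inl ?_) h.mirrors (fun n _ hn => .inl hn) ?_) ?_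
    · refine congrArg (s.core.copy g.mem g.life) (EBRConf.delayed_eq t ?_
        (fun _ _ => rfl) ?_)
      · simp +contextual [EBRConf.setPhase, EBRConf.setList]
      · simp [EBRConf.delayed, EBRConf.setPhase, EBRConf.setList, hp, Phase.IsPrelude]
    · intro v n e hv
      simp only [EBRConf.setPhase, EBRConf.setList, Function.update_apply]
      split_ifs <;> simp [hv]
    · rintro g' ⟨hg, hm, hl⟩
      refine ⟨g', hg, .inr ⟨rfl, by rw [hm, hl]; rfl, ?_⟩⟩
      simp [EBRConf.overhead, EBRConf.setPhase, EBRConf.setList, hp]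
  | reclaim t e n L hp hL =>
    have hmem : n ∈ s.lists t (Fin.ofNat 3 (e + 1)) := hL ▸ List.mem_cons_self
    obtain ⟨h1, h2, h3⟩ := h.lists.mem_list _ _ _ hmem
    have h4 := h.lists.bound t e _ n (.inr hp) hmem
    have h5 := h.epochs.reclaim t e hp
    -- `ret n ≤ e` and `ret n ≡ e + 1` modulo 3 exclude the epochs `e` and `e - 1`.
    have h6 : g.ret n + 2 ≤ s.epoch := by
      simp only [Fin.val_ofNat] at h2
      omega
    have hmir : Config.Mirrors
        { s.core with life := Function.update s.core.life n .unallocated } g.mem g.life := by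
      have hne : ∀ k, Function.update s.core.life n .unallocated k ≠ .unallocated →
          s.core.life k ≠ .unallocated := by
        intro k hk
        rcases eq_or_ne k n with rfl | hkn
        · simp at hk
        · simpa [hkn] using hk
      refine ⟨fun k => ?_, fun k hk => h.mirrors.mem k (hne k hk),
        fun k k' hk hk' => h.mirrors.inj k k' (hne k hk) (hne k' hk')⟩
      rcases eq_or_ne k n with rfl | hkn
      · simp [h1]
      · simpa [hkn] using h.mirrors.life k
    refine Exists.elim (h.quiet hs0 (.inl rfl) hmir (fun k _ hk => ?_) (fun v k e hv => ?_)) ?_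
    · rcases eq_or_ne k n with rfl | hkn
      · exact .inr h6
      · exact .inl (by simpa [EBRConf.setList, hkn] using hk)
    · simp [EBRConf.setList, hv]
    · rintro g' ⟨hg, hm, hl⟩
      refine ⟨g', hg, .inr ⟨rfl, by rw [hm, hl]; rfl, ?_⟩⟩
      have : ∑ k, (Function.update (s.lists t) (Fin.ofNat 3 (e + 1)) L k).length <
          ∑ k, (s.lists t k).length := by
        refine Finset.sum_lt_sum (fun k _ => ?_) ⟨Fin.ofNat 3 (e + 1), Finset.mem_univ _, ?_⟩
        · rcases eq_or_ne k (Fin.ofNat 3 (e + 1)) with rfl | hk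
          · rw [Function.update_self, hL]
            exact Nat.le_succ _
          · rw [Function.update_of_ne hk]
        · rw [Function.update_self, hL]
          exact Nat.lt_succ_self _
      simp only [EBRConf.overhead, EBRConf.setList, hp, Function.update_self]
      omega
  | scanFail t _ _ hp | advance t _ hp =>
    -- The end of `begin_op` is the delayed invocation.
    obtain ⟨o, ho⟩ := h.thr.prelude t (by rw [hp]; trivial)
    refine Exists.elim (h.quiet hs0 (.inr ⟨⟨t, some (.inv o), none⟩, ?_⟩) h.mirrors
      (fun n _ hn => .inl hn) ?_) ?_
    · refine .invoke _ _ _ _ ⟨?_, ?_⟩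
      · simp [Config.copy, EBRConf.delayed, hp, Phase.IsPrelude]
      · refine congrArg (s.core.copy g.mem g.life) (EBRConf.delayed_eq_update t ?_ ?_ ?_)
        · simp +contextual [EBRConf.setPhase]
        · simp +contextual [EBRConf.setPhase]
        · simp [EBRConf.delayed, EBRConf.setPhase, Phase.IsPrelude, ho]
    · intro u n e hu
      simp only [EBRConf.setPhase, Function.update_apply]
      split_ifs <;> simp [hu]
    · rintro g' ⟨hg, hm, hl⟩
      refine ⟨g', hg, .inr ⟨rfl, by rw [hm, hl]; rfl, ?_⟩⟩
      simp [EBRConf.overhead, EBRConf.setPhase, hp]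
  | body t d c' hp hb =>
    obtain ⟨m, life, h1, h2, h3, h4, h5, h6⟩ := h.mirrors.body
      (h.reach.wellFormed.life) (fun o pc ρ r n k => h.reg_not_reclaimed hI hp)
      (fun o pc ρ L d e w cell n k => h.cas_not_reclaimed hI hp) hb
    have hd : ({ s with core := c' } : EBRConf N Op).delayed =
        Function.update s.delayed t (c'.thr t) := by
      ext u
      rcases eq_or_ne u t with rfl | hut
      · simp [EBRConf.delayed, hp, Phase.IsPrelude]
      · simp [EBRConf.delayed, hut, hb.thr_of_ne hut]
    obtain ⟨g', hg, hm, hl⟩ := h.next hs0 m life g.ret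
      (.inr ⟨_, .body _ _ _ _ (by rw [hd]; exact h2 _ (delayed_of_body hp))⟩) h1
      (fun n => (h5 n).2) (fun _ _ => rfl) (fun n e1 e2 => absurd ((h5 n).1 e1) e2)
      (fun n e1 e2 => .inl ((h6 n ((h5 n).2 e1)).symm.trans e2))
      (fun u n e e1 e2 => by simp [e1] at e2)
    refine ⟨g', hg, .inl (.body _ _ _ _ ?_)⟩
    have := h2 _ rfl
    rw [← h3] at this
    rw [hm, hl]
    exact this
  | retire t n c' hp hr =>
    obtain ⟨o, pc, ρ, r, k, ht, hc, hr, hc'⟩ := hr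
    have hd : (({ s with core := c' } : EBRConf N Op).setPhase t (.insert n s.epoch)).delayed =
        Function.update s.delayed t (.run o (pc + 1) ρ) := by
      refine EBRConf.delayed_eq_update t ?_ ?_ ?_
      · simp +contextual [EBRConf.setPhase]
      · simp +contextual [EBRConf.setPhase, hc']
      · simp [EBRConf.delayed, EBRConf.setPhase, Phase.IsPrelude, hc']
    subst hc'
    have hact : g.life n = .active :=
      h.reach.active_of_retire hI ((delayed_of_body hp).trans ht) hc hr
    have hact' : s.core.life n = .active := by
      rcases h.mirrors.life n with e | ⟨-, e⟩
      · exact e.trans hact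
      · exact absurd (hact.symm.trans e) (by simp)
    have hstep : ∀ th, th t = s.core.thr t → RetireStep I (s.core.copy g.mem g.life th) t n
        ((s.core.copy g.mem (Function.update g.life n .retired)
          (Function.update th t (.run o (pc + 1) ρ)))) := fun th hth =>
      ⟨o, pc, ρ, r, k, hth.trans ht, hc, hr, by simp [Config.copy, hact]⟩
    refine Exists.elim (h.next hs0 g.mem (Function.update g.life n .retired)
      (Function.update g.ret n s.epoch) (.inr ⟨_, .retire _ t n _ ?_⟩) ?_ ?_ ?_ ?_ ?_ ?_) ?_
    · rw [hd]
      exact hstep _ (delayed_of_body hp)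
    · have hne : ∀ j, Function.update s.core.life n .retired j ≠ .unallocated →
          s.core.life j ≠ .unallocated := by
        intro j hj
        rcases eq_or_ne j n with rfl | hjn
        · simp [hact']
        · simpa [hjn] using hj
      simp only [EBRConf.setPhase, hact']
      refine ⟨fun j => ?_, fun j hj => h.mirrors.mem j (hne j hj),
        fun j j' hj hj' => h.mirrors.inj j j' (hne j hj) (hne j' hj')⟩
      rcases eq_or_ne j n with rfl | hjn
      · simp
      · simpa [hjn] using h.mirrors.life j
    · intro j hj
      rcases eq_or_ne j n with rfl | hjn <;> simp [*]
    · intro j hj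
      have : j ≠ n := by
        rintro rfl
        simp [hact] at hj
      simp [this]
    · intro j hj hj'
      rcases eq_or_ne j n with rfl | hjn
      · simp [EBRConf.setPhase, hact']
      · simp [hjn, hj'] at hj
    · intro j hj hj'
      have : j ≠ n := by
        rintro rfl
        simp [hact] at hj
      exact .inl (by simpa [EBRConf.setPhase, this] using hj')
    · intro u j e hu hu'
      simp only [EBRConf.setPhase, Function.update_apply] at hu'
      split_ifs at hu'
      · cases hu'
        simp
      · simp [hu] at hu'
    · rintro g' ⟨hg, hm, hl⟩
      refine ⟨g', hg, .inl (.retire _ _ n _ ?_)⟩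
      rw [hm, hl]
      exact hstep _ rfl

end EBRConf.Simulated

/-! ### Memory safety, linearizability and progress -/

theorem EBRConf.Simulated.valid_deref {I : Impl N Op} (hI : IsPlain I) {s s' : EBRConf N Op}
    {g : Ghost N} (h : s.Simulated I g) {l : Label N Op} (hs : EBRStep I s l s') {w : Word}
    (hw : l.deref = some w) : s.core.Valid w := by
  cases hs with
  | body t d c' hp hb =>
    cases hb with
    | access o pc ρ L a cell ht hc hL =>
      cases L with
      | root ix => cases hw
      | field p ix =>
        cases hw
        cases hr : ρ p with
        | val z => simp [LocRef.resolve, hr] at hL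
        | ptr n k => exact h.reg_not_reclaimed hI hp ht hr
    | _ => cases hw
  | _ => cases hw

/-- The plain execution `F` performs the steps of `E` at the same times, except for steps in the code of
EBR, which are not events of the history and decrease the overhead of their thread. -/
structure Exec.Refines {I : Impl N Op} (E : Exec (ebr N Op I)) (F : Exec (plain I)) : Prop where
  lab : ∀ i, F.lab i = E.lab i ∨ F.lab i = none ∧ ∃ l, E.lab i = some l ∧ l.ev = none ∧
    (E.conf (i + 1)).overhead l.tid < (E.conf i).overhead l.tid

theorem exists_refines {I : Impl N Op} (hI : IsPlain I) (E : Exec (ebr N Op I)) :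
    ∃ g : ℕ → Ghost N, (∀ i, (E.conf i).Simulated I (g i)) ∧
      ∃ F : Exec (plain I), E.Refines F := by
  have key : ∀ i (g : {g // (E.conf i).Simulated I g}),
      ∃ (g' : {g // (E.conf (i + 1)).Simulated I g}) (lab : Option (Label N Op)),
        (match lab with
          | none => (E.conf (i + 1)).core.copy g'.1.mem g'.1.life (E.conf (i + 1)).core.thr =
              (E.conf i).core.copy g.1.mem g.1.life (E.conf i).core.thr
          | some l => PlainStep I ((E.conf i).core.copy g.1.mem g.1.life (E.conf i).core.thr) l
              ((E.conf (i + 1)).core.copy g'.1.mem g'.1.life (E.conf (i + 1)).core.thr)) ∧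
        (lab = E.lab i ∨ lab = none ∧ ∃ l, E.lab i = some l ∧ l.ev = none ∧
          (E.conf (i + 1)).overhead l.tid < (E.conf i).overhead l.tid) := by
    rintro i ⟨g, hg⟩
    have hs := E.step i
    cases hl : E.lab i with
    | none =>
      rw [hl] at hs
      change E.conf (i + 1) = E.conf i at hs
      rw [hs]
      exact ⟨⟨g, hg⟩, none, rfl, .inl rfl⟩
    | some l =>
      rw [hl] at hs
      obtain ⟨g', hg', h | ⟨h1, h2, h3⟩⟩ := hg.step hI hs
      · exact ⟨⟨g', hg'⟩, some l, h, .inl rfl⟩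
      · exact ⟨⟨g', hg'⟩, none, h2, .inr ⟨rfl, l, rfl, h1, h3⟩⟩
  choose next lab hstep hlab using key
  obtain ⟨g0, hg0, hm0⟩ : ∃ g, (E.conf 0).Simulated I g ∧
      (E.conf 0).core.copy g.mem g.life (E.conf 0).core.thr = I.initial := by
    rw [E.start]
    exact EBRConf.Simulated.start I
  let g : ∀ i, {g // (E.conf i).Simulated I g} := Nat.rec ⟨g0, hg0⟩ next
  exact ⟨fun i => (g i).1, fun i => (g i).2,
    ⟨fun i => (E.conf i).core.copy (g i).1.mem (g i).1.life (E.conf i).core.thr,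
      fun i => lab i (g i), hm0, fun i => hstep i (g i)⟩, ⟨fun i => hlab i (g i)⟩⟩

namespace Exec.Refines

variable {I : Impl N Op} {E : Exec (ebr N Op I)} {F : Exec (plain I)}

theorem history_eq (h : E.Refines F) (m : ℕ) : F.history m = E.history m := by
  refine List.filterMap_congr fun i _ => ?_
  rcases h.lab i with e | ⟨e, l, hl, hev, -⟩
  · rw [e]
  · simp [e, hl, hev]

theorem invokesAt_iff (h : E.Refines F) (t : Fin N) (i : ℕ) :
    F.InvokesAt t i ↔ E.InvokesAt t i := by
  unfold InvokesAt
  rcases h.lab i with e | ⟨e, l, hl, hev, -⟩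
  · rw [e]
  · simp [e, hl, hev]

theorem respondsAt_iff (h : E.Refines F) (t : Fin N) (i : ℕ) :
    F.RespondsAt t i ↔ E.RespondsAt t i := by
  unfold RespondsAt
  rcases h.lab i with e | ⟨e, l, hl, hev, -⟩
  · rw [e]
  · simp [e, hl, hev]

theorem pending_iff (h : E.Refines F) (t : Fin N) (k : ℕ) : F.Pending t k ↔ E.Pending t k := by
  simp [Pending, h.invokesAt_iff, h.respondsAt_iff]

theorem moves (h : E.Refines F) {t : Fin N} {i : ℕ} (hm : F.Moves t i) : E.Moves t i := by
  obtain ⟨l, hl, ht⟩ := hm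
  rcases h.lab i with e | ⟨e, -⟩
  · exact ⟨l, e ▸ hl, ht⟩
  · simp [e] at hl

/-- A thread cannot perform infinitely many steps in the code of EBR only. -/
theorem exists_moves (h : E.Refines F) {t : Fin N} (ht : ∀ m, ∃ i ≥ m, E.Moves t i) (m : ℕ) :
    ∃ i ≥ m, F.Moves t i := by
  by_contra! hF
  have hle : ∀ i ≥ m, (E.conf (i + 1)).overhead t ≤ (E.conf i).overhead t ∧
      (E.Moves t i → (E.conf (i + 1)).overhead t < (E.conf i).overhead t) := by
    intro i hi
    have hs := E.step i
    cases hl : E.lab i with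
    | none =>
      rw [hl] at hs
      change E.conf (i + 1) = E.conf i at hs
      exact ⟨by rw [hs], fun ⟨l, hl', _⟩ => by simp [hl] at hl'⟩
    | some l =>
      rw [hl] at hs
      by_cases hlt : t = l.tid
      · rcases h.lab i with e | ⟨-, l', hl', -, hlt'⟩
        · exact absurd ⟨l, e.trans hl, hlt.symm⟩ (hF i hi)
        · obtain rfl : l = l' := Option.some.inj (hl.symm.trans hl')
          subst hlt
          exact ⟨hlt'.le, fun _ => hlt'⟩
      · refine ⟨(hs.overhead_of_ne hlt).le, fun ⟨l', hl', h'⟩ => ?_⟩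
        obtain rfl : l = l' := Option.some.inj (hl.symm.trans hl')
        exact absurd h'.symm hlt
  have hmono : ∀ i ≥ m, ∀ j, (E.conf (i + j)).overhead t ≤ (E.conf i).overhead t := by
    intro i hi j
    induction j with
    | zero => exact le_rfl
    | succ j ih => exact (hle (i + j) (by omega)).1.trans ih
  have hdec : ∀ b, ∃ i ≥ m, (E.conf i).overhead t + b ≤ (E.conf m).overhead t := by
    intro b
    induction b with
    | zero => exact ⟨m, le_rfl, le_rfl⟩
    | succ b ih =>
      obtain ⟨i, hi, hb⟩ := ih
      obtain ⟨j, hj, hmv⟩ := ht i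
      obtain ⟨d, rfl⟩ := Nat.exists_eq_add_of_le hj
      have h1 := (hle (i + d) (by omega)).2 hmv
      have h2 := hmono i hi d
      exact ⟨i + d + 1, by omega, by omega⟩
  obtain ⟨i, -, hi⟩ := hdec ((E.conf m).overhead t + 1)
  omega

theorem pendingEffective (h : E.Refines F) {t : Fin N} {k : ℕ} (ht : E.PendingEffective t k) :
    F.PendingEffective t k := by
  refine ⟨(h.pending_iff t k).2 ht.1, ht.2.imp ?_ h.exists_moves⟩
  rintro ⟨i, hi, hr⟩
  exact ⟨i, hi, (h.respondsAt_iff t i).2 hr⟩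

theorem maximalProgress (h : E.Refines F) (hF : F.MaximalProgress) : E.MaximalProgress := by
  intro k t ht
  obtain ⟨i, hi, hr⟩ := hF k t (h.pendingEffective ht)
  exact ⟨i, hi, (h.respondsAt_iff t i).1 hr⟩

theorem minimalProgress (h : E.Refines F) (hF : F.MinimalProgress) : E.MinimalProgress := by
  rintro k ⟨t, ht⟩
  obtain ⟨i, hi, u, hr⟩ := hF k ⟨t, h.pendingEffective ht⟩
  exact ⟨i, hi, u, (h.respondsAt_iff u i).1 hr⟩

theorem eventuallySolo (h : E.Refines F) (hE : E.EventuallySolo) : F.EventuallySolo := by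
  obtain ⟨t, m, ht⟩ := hE
  exact ⟨t, m, fun i hi u hu => ht i hi u (h.moves hu)⟩

theorem fair (h : E.Refines F) (hE : E.Fair) : F.Fair := by
  intro t k hk
  by_contra! hF
  have hno : ∀ i ≥ k, ¬ E.RespondsAt t i := by
    intro i hi hr
    obtain ⟨l, v, hl, ht, -⟩ := (h.respondsAt_iff t i).2 hr
    exact hF i hi ⟨l, hl, ht⟩
  obtain ⟨i, hi, hinv, hres⟩ := (h.pending_iff t k).1 hk
  have hpend : ∀ m ≥ k, E.Pending t m := by
    refine fun m hm => ⟨i, by omega, hinv, fun j hij hjm => ?_⟩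
    rcases Nat.lt_or_ge j k with hj | hj
    exacts [hres j hij hj, hno j hj]
  obtain ⟨j, hj, hmv⟩ := h.exists_moves (t := t) (fun m => by
    obtain ⟨j, hj, hmv⟩ := hE t (max m k) (hpend _ (le_max_right _ _))
    exact ⟨j, (le_max_left _ _).trans hj, hmv⟩) k
  exact hF j hj hmv

end Exec.Refines

theorem Exec.stutter_not_pending (M : System N Op) (t : Fin N) (k : ℕ) :
    ¬ (Exec.stutter M).Pending t k := by
  rintro ⟨i, -, ⟨l, o, hl, -⟩, -⟩
  cases hl

end SMR

theorem mainTheorem2 (N : ℕ) (Op : Type) : SMR.StronglyApplicable (SMR.ebr N Op) := by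
  intro I hI
  refine ⟨fun E i l w hl hw => ?_, fun spec hspec E m => ?_, fun p hp => ?_⟩
  · obtain ⟨g, hg, -⟩ := SMR.exists_refines hI E
    have hs := E.step i
    rw [hl] at hs
    exact (hg i).valid_deref hI hs hw
  · obtain ⟨-, -, F, hF⟩ := SMR.exists_refines hI E
    rw [← hF.history_eq m]
    exact hspec F m
  · have href := fun E => (SMR.exists_refines hI E).choose_spec.2
    -- The execution in which nothing happens is fair and provides maximal progress, which settles the
    -- existential clauses of lock-freedom and deadlock-freedom.
    have hmax : (SMR.Exec.stutter (SMR.ebr N Op I)).MaximalProgress :=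
      fun k t ht => absurd ht.1 (SMR.Exec.stutter_not_pending _ t k)
    have hfair : (SMR.Exec.stutter (SMR.ebr N Op I)).Fair :=
      fun t k ht => absurd ht (SMR.Exec.stutter_not_pending _ t k)
    cases p with
    | waitFree =>
      intro E
      obtain ⟨F, hF⟩ := href E
      exact hF.maximalProgress (hp F)
    | lockFree =>
      refine ⟨fun E => ?_, _, hmax⟩
      obtain ⟨F, hF⟩ := href E
      exact hF.minimalProgress (hp.1 F)
    | obstructionFree =>
      intro E hE
      obtain ⟨F, hF⟩ := href E
      exact hF.maximalProgress (hp F (hF.eventuallySolo hE))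
    | starvationFree =>
      intro E hE
      obtain ⟨F, hF⟩ := href E
      exact hF.maximalProgress (hp F (hF.fair hE))
    | deadlockFree =>
      refine ⟨fun E hE => ?_, _, hfair, hmax⟩
      obtain ⟨F, hF⟩ := href E
      exact hF.minimalProgress (hp.1 F (hF.fair hE))
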